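/- Let $p\ge 2$ and let $X_2$ be a Riemannian symmetric space of compact type: a connected Riemannian manifold with a geodesic symmetry at every point, such that the Killing form of the Lie algebra $\mathfrak g$ of its isometry group (the Lie algebra of Killing fields) is negative definite, and whose metric on $T_xX_2\cong\mathfrak m$ is the restriction of the negative of the Killing form, where $\mathfrak m\subseteq\mathfrak g$ is the $-1$ eigenspace of the involution given by the symmetry at $x$. Give $S^p=SO(p+1)/SO(p)$ the metric induced by the negative of the Killing form of $\mathfrak{so}(p+1)$, i.e. the round metric of constant sectional curvature $\frac1{2(p-1)}$, and give $X=S^p\times X_2$ the product metric. Let $R_{u,v}w=\nabla_u\nabla_vw-\nabla_v\nabla_uw-\nabla_{[u,v]}w$ be the curvature tensor of $X$, and let $\rho$ be the smallest Ricci curvature of a unit tangent vector of $X$. For an immersed $p$-dimensional submanifold $M$ of $X$ with second fundamental form $B(x,y)=(\nabla_xy)^N$, let $A^W$, for a normal vector $W$, be the symmetric endomorphism of $TM$ with $\langle A^Wx,y\rangle=\langle B(x,y),W\rangle$; $M$ is minimal if every $A^W$ is trace-free. Let $R(A)$ be the section of $\mathrm{Hom}(NM,S(TM))$ given, for an orthonormal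 basis $e_1,\dots,e_p$ of the tangent space of $M$, by $$\langle R(A)^Wx,y\rangle=\sum_{i=1}^p\Big(2\langle R_{e_i,y}B(x,e_i),W\rangle+2\langle R_{e_i,x}B(y,e_i),W\rangle-\langle A^Wx,R_{e_i,y}e_i\rangle-\langle A^Wy,R_{e_i,x}e_i\rangle+\langle R_{e_i,B(x,y)}e_i,W\rangle-2\langle A^We_i,R_{e_i,x}y\rangle\Big),$$ and, for an orthonormal basis $\eta_j$ of the normal space, let $\langle R(A),A\rangle=\sum_{j,k}\langle R(A)^{\eta_j}e_k,A^{\eta_j}e_k\rangle$ and $\|A\|^2=\sum_{j,k}|A^{\eta_j}e_k|^2$. Then there is a constant $C=C(p,X_2)>0$ such that for every closed (compact, without boundary) $p$-dimensional minimal immersed submanifold $M$ of $S^p\times X_2$ and every $\Lambda\ge0$ such that the derivative $\pi_2:TM\to TX_2$ of the projection of $M$ to $X_2$ has operator norm at most $\Lambda$ at every point of $M$, the inequality $$\langle R(A),A\rangle\ \ge\ \Big(\big(2\rho+\tfrac1{p-1}\big)-C\Lambda^2\Big)\|A\|^2$$ holds at every point of $M$. -/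

import Mathlib

open scoped Manifold ContDiff Bundle
open Module

set_option maxSynthPendingDepth 3

noncomputable section

/-! ## Riemannian geometry in charts

Manifolds are boundaryless and finite-dimensional. The tangent space `TangentSpace I x` is the model
vector space `E`, read in the preferred chart `extChartAt I x` at `x`; accordingly, tensors at `x`
are computed in this chart. -/

section Geometry

variable {E : Type*} [NormedAddCommGroup E] [NormedSpace ℝ E]
  {H : Type*} [TopologicalSpace H] {I : ModelWithCorners ℝ E H}
  {X : Type*} [TopologicalSpace X] [ChartedSpace H X]
  {E' : Type*} [NormedAddCommGroup E'] [NormedSpace ℝ E']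
  {H' : Type*} [TopologicalSpace H'] {I' : ModelWithCorners ℝ E' H'}
  {X' : Type*} [TopologicalSpace X'] [ChartedSpace H' X']

variable (I X) in
/-- A field of bilinear forms on the tangent spaces of `X`, such as a Riemannian metric. -/
abbrev MetricField := ∀ x : X, TangentSpace I x →L[ℝ] TangentSpace I x →L[ℝ] ℝ

/-- The metric at `x`, as a bilinear form on the model vector space. -/
def MetricField.at (g : MetricField I X) (x : X) : E →L[ℝ] E →L[ℝ] ℝ := g x

/-- The metric read in the chart `φ` at `x`: the pullback of `g` by `φ⁻¹`, at the point `y`. -/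
def chartMetric (g : MetricField I X) (x : X) (y : E) : E →L[ℝ] E →L[ℝ] ℝ :=
  let φ := extChartAt I x
  let D : E →L[ℝ] E := mfderiv 𝓘(ℝ, E) I φ.symm y
  (MetricField.at g (φ.symm y)).bilinearComp D D

/-- The Christoffel symbols of the first kind in the chart at `x`, at the point `y`:
`(u, v) ↦ (w ↦ (∂_u g(v, w) + ∂_v g(u, w) - ∂_w g(u, v)) / 2)`. -/
def christoffelFirst (g : MetricField I X) (x : X) (y : E) : E →L[ℝ] E →L[ℝ] (E →L[ℝ] ℝ) :=
  let D : E →L[ℝ] E →L[ℝ] E →L[ℝ] ℝ := fderiv ℝ (chartMetric g x) y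
  (1 / 2 : ℝ) • (D + D.flip
    - ((ContinuousLinearMap.flipₗᵢ ℝ E E ℝ).toContinuousLinearEquiv :
        (E →L[ℝ] E →L[ℝ] ℝ) →L[ℝ] (E →L[ℝ] E →L[ℝ] ℝ)) ∘L D.flip)

/-- The defining (Koszul) formula of `christoffelFirst`. -/
theorem christoffelFirst_apply (g : MetricField I X) (x : X) (y u v w : E) :
    christoffelFirst g x y u v w =
      (1 / 2 : ℝ) * (fderiv ℝ (chartMetric g x) y u v w + fderiv ℝ (chartMetric g x) y v u w
        - fderiv ℝ (chartMetric g x) y w u v) := by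
  simp [christoffelFirst]

/-- The Christoffel symbols `Γ(u, v)` of the Levi-Civita connection of `g` in the chart at `x`, at
the point `y`. The map `(chartMetric g x y).inverse` raises an index. -/
def christoffel (g : MetricField I X) (x : X) (y : E) : E →L[ℝ] E →L[ℝ] E :=
  (ContinuousLinearMap.compL ℝ E (E →L[ℝ] ℝ) E (chartMetric g x y).inverse) ∘L
    (christoffelFirst g x y)

/-- The Riemann curvature tensor `R_{u,v} w = ∇_u ∇_v w - ∇_v ∇_u w - ∇_{[u,v]} w` of `g` at `x`.
With this sign the sectional curvature of the plane of orthonormal `u, v` is `g(R_{u,v} v, u)`. -/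
def curvature (g : MetricField I X) (x : X) (u v w : E) : E :=
  let y := extChartAt I x x
  let Γ := christoffel g x y
  let DΓ : E →L[ℝ] E →L[ℝ] E →L[ℝ] E := fderiv ℝ (christoffel g x) y
  DΓ u v w - DΓ v u w + Γ u (Γ v w) - Γ v (Γ u w)

/-- The Ricci curvature `Ric(v, w)` of `g` at `x`: the trace of `z ↦ R_{z,v} w`. -/
def ricci (g : MetricField I X) (x : X) (v w : E) : ℝ :=
  LinearMap.trace ℝ E
    { toFun := fun z ↦ curvature g x z v w
      map_add' := fun a b ↦ by simp [curvature]; abel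
      map_smul' := fun c a ↦ by simp [curvature, smul_sub, smul_add] }

/-- The smallest Ricci curvature of a unit tangent vector. -/
def smallestRicci (g : MetricField I X) : ℝ :=
  sInf {r : ℝ | ∃ (x : X) (v : E), g x v v = 1 ∧ r = ricci g x v v}

/-- The product metric on `X × X'`. -/
def MetricField.prod (g : MetricField I X) (g' : MetricField I' X') :
    MetricField (I.prod I') (X × X') := fun x ↦
  show E × E' →L[ℝ] E × E' →L[ℝ] ℝ from
    (g.at x.1).bilinearComp (ContinuousLinearMap.fst ℝ E E') (ContinuousLinearMap.fst ℝ E E')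
    + (g'.at x.2).bilinearComp (ContinuousLinearMap.snd ℝ E E') (ContinuousLinearMap.snd ℝ E E')

/-! ### Immersed submanifolds -/

variable {F : Type*} [NormedAddCommGroup F] [NormedSpace ℝ F]
  {G : Type*} [TopologicalSpace G] {J : ModelWithCorners ℝ F G}
  {M : Type*} [TopologicalSpace M] [ChartedSpace G M]

variable (I J) in
/-- The differential of `f` at `m`, between the model vector spaces. -/
def tangentMap' (f : M → X) (m : M) : F →L[ℝ] E := mfderiv J I f m

variable (J) in
/-- The metric induced on `M` by `f : M → X`. -/
def inducedMetric (g : MetricField I X) (f : M → X) (m : M) : F →L[ℝ] F →L[ℝ] ℝ :=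
  (g.at (f m)).bilinearComp (tangentMap' I J f m) (tangentMap' I J f m)

variable (I J) in
/-- A smooth immersion. -/
structure IsSmoothImmersion (f : M → X) : Prop where
  contMDiff : ContMDiff J I ∞ f
  injective_mfderiv : ∀ m, Function.Injective (mfderiv J I f m)

variable (J) in
/-- The vector `η`, tangent to `X` at `f m`, is normal to `M` at `m`. -/
def IsNormalAt (g : MetricField I X) (f : M → X) (m : M) (η : E) : Prop :=
  ∀ u : F, g (f m) η (tangentMap' I J f m u) = 0

variable (J) in
/-- The orthogonal projection of `T_{f m} X` onto the normal space of `M` at `m`: the identity minus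
the tangential part, where the tangential part of `w` is `df t` for the `t` such that
`⟨df t, df u⟩ = ⟨w, df u⟩` for all `u` tangent to `M`. -/
def normalProj (g : MetricField I X) (f : M → X) (m : M) : E →L[ℝ] E :=
  let df := tangentMap' I J f m
  ContinuousLinearMap.id ℝ E - df ∘L (inducedMetric J g f m).inverse ∘L
    ((ContinuousLinearMap.compL ℝ F E ℝ).flip df ∘L g.at (f m))

variable (J) in
/-- The second derivative `(u, v) ↦ ∇_u (df v)` of `f` at `m`, where `v` is extended as a constant
vector field in the chart of `M` at `m` and `∇` is the Levi-Civita connection of `X`. -/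
def covariantHessian (g : MetricField I X) (f : M → X) (m : M) : F →L[ℝ] F →L[ℝ] E :=
  let df := tangentMap' I J f m
  fderiv ℝ (fderiv ℝ (writtenInExtChartAt J I m f)) (extChartAt J m m)
    + (christoffel g (f m) (extChartAt I (f m) (f m))).bilinearComp df df

variable (J) in
/-- The second fundamental form `B(u, v) = (∇_u (df v))^N` of `M` at `m`. -/
def secondFundamentalForm (g : MetricField I X) (f : M → X) (m : M) : F →L[ℝ] F →L[ℝ] E :=
  (ContinuousLinearMap.compL ℝ F E E (normalProj J g f m)) ∘L covariantHessian J g f m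

variable (J) in
/-- The second fundamental form as a map `A` from normal vectors to endomorphisms of the tangent
space: `⟨A^η u, v⟩ = ⟨B(u, v), η⟩`, that is, `A^η u = -(∇_u η)^T`. -/
def shapeOperator (g : MetricField I X) (f : M → X) (m : M) (η : E) : F →L[ℝ] F :=
  (inducedMetric J g f m).inverse ∘L
    (ContinuousLinearMap.compL ℝ F E ℝ ((g.at (f m)).flip η)) ∘L secondFundamentalForm J g f m

variable (J) in
/-- `f : M → X` is minimal: `A^η` is trace-free for every normal vector `η`. -/
def IsMinimal (g : MetricField I X) (f : M → X) : Prop :=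
  ∀ (m : M) (η : E), IsNormalAt J g f m η →
    LinearMap.trace ℝ F (shapeOperator J g f m η : F →ₗ[ℝ] F) = 0

variable (J) in
/-- `e` is an orthonormal system of tangent vectors of `M` at `m`, and `η` is an orthonormal system
of normal vectors. (They are bases of the tangent and of the normal space as soon as they have
`dim M`, resp. `dim X - dim M`, elements.) -/
structure IsAdaptedFrame (g : MetricField I X) (f : M → X) (m : M) {ι κ : Type*}
    (e : ι → F) (η : κ → E) : Prop where
  tangent_self : ∀ i, inducedMetric J g f m (e i) (e i) = 1
  tangent_ne : ∀ i j, i ≠ j → inducedMetric J g f m (e i) (e j) = 0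
  normal_self : ∀ i, g (f m) (η i) (η i) = 1
  normal_ne : ∀ i j, i ≠ j → g (f m) (η i) (η j) = 0
  isNormalAt : ∀ i, IsNormalAt J g f m (η i)

variable {ι κ : Type*} [Fintype ι] [Fintype κ]

variable (J) in
/-- The curvature term `⟨R(A)^W x, y⟩` of Simons' equation, where `e` is an orthonormal basis of the
tangent space of `M` at `m`. -/
def simonsTerm (g : MetricField I X) (f : M → X) (m : M) (e : ι → F) (W : E) (x y : F) : ℝ :=
  let df := tangentMap' I J f m
  let R := curvature g (f m)
  let B := secondFundamentalForm J g f m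
  let A := shapeOperator J g f m
  let ip := g.at (f m)
  ∑ i, (2 * ip (R (df (e i)) (df y) (B x (e i))) W
      + 2 * ip (R (df (e i)) (df x) (B y (e i))) W
      - ip (df (A W x)) (R (df (e i)) (df y) (df (e i)))
      - ip (df (A W y)) (R (df (e i)) (df x) (df (e i)))
      + ip (R (df (e i)) (B x y) (df (e i))) W
      - 2 * ip (df (A W (e i))) (R (df (e i)) (df x) (df y)))

variable (J) in
/-- The inner product `⟨R(A), A⟩` of sections of `Hom(N_M, S(M))`, in an adapted orthonormal
frame. -/
def simonsInner (g : MetricField I X) (f : M → X) (m : M) (e : ι → F) (η : κ → E) : ℝ :=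
  ∑ j, ∑ k, ∑ l, simonsTerm J g f m e (η j) (e k) (e l)
    * inducedMetric J g f m (shapeOperator J g f m (η j) (e k)) (e l)

variable (J) in
/-- The squared norm `‖A‖²` of the second fundamental form, in an adapted orthonormal frame. -/
def normSqA (g : MetricField I X) (f : M → X) (m : M) (e : ι → F) (η : κ → E) : ℝ :=
  ∑ j, ∑ k, inducedMetric J g f m (shapeOperator J g f m (η j) (e k))
    (shapeOperator J g f m (η j) (e k))

/-! ### Symmetric spaces of compact type -/

/-- A diffeomorphism `σ` is an isometry of `g`. -/
def IsIsometryOf (g : MetricField I X) (σ : X ≃ₘ⟮I, I⟯ X) : Prop :=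
  ∀ (x : X) (v w : TangentSpace I x), g (σ x) (mfderiv I I σ x v) (mfderiv I I σ x w) = g x v w

/-- `σ` is a geodesic symmetry at `x`: an isometry that fixes `x` and has derivative `-id` there.
(As `σ x = x`, both tangent spaces are the model vector space, read in the same chart.) -/
structure IsSymmetryAt (g : MetricField I X) (x : X) (σ : X ≃ₘ⟮I, I⟯ X) : Prop where
  isometry : IsIsometryOf g σ
  fixed : σ x = x
  derivative : ∀ v : E, (mfderiv I I σ x v : E) = -v

variable [IsManifold I ∞ X]

/-- A smooth vector field on `X`. -/
def IsSmoothField (V : ∀ x : X, TangentSpace I x) : Prop :=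
  ContMDiff I I.tangent ∞ (fun x ↦ (⟨x, V x⟩ : TangentBundle I X))

/-- A Killing field: a smooth vector field `V` such that the Lie derivative of the metric along `V`
is zero, `V (g(Y, Z)) = g([V, Y], Z) + g(Y, [V, Z])` for all smooth vector fields `Y`, `Z`. -/
structure IsKillingField (g : MetricField I X) (V : ∀ x : X, TangentSpace I x) : Prop where
  smooth : IsSmoothField V
  lie_metric : ∀ Y Z : ∀ x : X, TangentSpace I x, IsSmoothField Y → IsSmoothField Z →
    ∀ x, (mfderiv I 𝓘(ℝ, ℝ) (fun y ↦ g y (Y y) (Z y)) x (V x) : ℝ)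
      = g x (VectorField.mlieBracket I V Y x) (Z x) + g x (Y x) (VectorField.mlieBracket I V Z x)

/-- The Lie algebra `𝔤` is the Lie algebra of all Killing fields of `g`, that is, the Lie algebra of
the isometry group: `φ` is an isomorphism of `𝔤` onto the Killing fields with their Lie bracket. -/
structure IsKillingAlgebra (g : MetricField I X) (𝔤 : Type*) [LieRing 𝔤] [LieAlgebra ℝ 𝔤]
    (φ : 𝔤 →ₗ[ℝ] (∀ x : X, TangentSpace I x)) : Prop where
  injective : Function.Injective φ
  mem_range : ∀ V : ∀ x : X, TangentSpace I x, IsKillingField g V ↔ ∃ a, φ a = V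
  lie : ∀ a b, φ ⁅a, b⁆ = VectorField.mlieBracket I (φ a) (φ b)

/-- `g` makes the connected manifold `X` a Riemannian symmetric space of compact type, with the
metric induced by the Killing form: there is a geodesic symmetry at every point, the Killing form of
the Lie algebra `𝔤` of the isometry group is negative definite, and for every point `x`, with
`𝔪 ⊆ 𝔤` the `-1` eigenspace of the involution of `𝔤` given by the symmetry at `x`, the metric on
`T_x X ≅ 𝔪` is the restriction of the negative of the Killing form. -/
structure IsCompactTypeSymmetric (g : MetricField I X) : Prop where
  connected : ConnectedSpace X
  symmetry : ∀ x, ∃ σ, IsSymmetryAt g x σ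
  compactType : ∃ (𝔤 : Type) (_ : LieRing 𝔤) (_ : LieAlgebra ℝ 𝔤) (_ : FiniteDimensional ℝ 𝔤)
    (φ : 𝔤 →ₗ[ℝ] (∀ x : X, TangentSpace I x)), IsKillingAlgebra g 𝔤 φ ∧
    (∀ a : 𝔤, a ≠ 0 → killingForm ℝ 𝔤 a a < 0) ∧
    ∀ (x : X) (σ : X ≃ₘ⟮I, I⟯ X), IsSymmetryAt g x σ →
      ∀ a b : 𝔤, (∀ y, mfderiv I I σ y (φ a y) = -φ a (σ y)) →
        (∀ y, mfderiv I I σ y (φ b y) = -φ b (σ y)) →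
        g x (φ a x) (φ b x) = -killingForm ℝ 𝔤 a b

end Geometry

/-! ### The ambient space `S^p × X₂` -/

/-- The `p`-sphere. -/
abbrev Sph (p : ℕ) := Metric.sphere (0 : EuclideanSpace ℝ (Fin (p + 1))) 1

/-- The metric on `S^p = SO(p+1)/SO(p)` given by the negative of the Killing form
`(p - 1) tr(a b)` of `𝔰𝔬(p+1)`: it is `2 (p - 1)` times the metric of the unit sphere, and has
constant sectional curvature `1 / (2 (p - 1))`. -/
def sphereMetric (p : ℕ) : MetricField (𝓡 p) (Sph p) := fun s ↦
  let D : EuclideanSpace ℝ (Fin p) →L[ℝ] EuclideanSpace ℝ (Fin (p + 1)) :=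
    mfderiv (𝓡 p) 𝓘(ℝ, EuclideanSpace ℝ (Fin (p + 1)))
      (fun q : Sph p ↦ (q : EuclideanSpace ℝ (Fin (p + 1)))) s
  show EuclideanSpace ℝ (Fin p) →L[ℝ] EuclideanSpace ℝ (Fin p) →L[ℝ] ℝ from
    (2 * ((p : ℝ) - 1)) • (innerSL ℝ).bilinearComp D D

/-- The product metric of `S^p × X₂`. -/
def ambientMetric (p : ℕ) {n : ℕ} {X₂ : Type*} [TopologicalSpace X₂]
    [ChartedSpace (EuclideanSpace ℝ (Fin n)) X₂] (g₂ : MetricField (𝓡 n) X₂) :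
    MetricField ((𝓡 p).prod (𝓡 n)) (Sph p × X₂) :=
  (sphereMetric p).prod g₂

/-- The derivative `π₂ : T M → T X₂` of the projection of `M` to the second factor has operator norm
at most `Λ` (where `Λ ≥ 0`) at every point of `M`. -/
def ProjNormLE {p n : ℕ} {X₂ : Type*} [TopologicalSpace X₂]
    [ChartedSpace (EuclideanSpace ℝ (Fin n)) X₂] (g₂ : MetricField (𝓡 n) X₂)
    {M : Type*} [TopologicalSpace M] [ChartedSpace (EuclideanSpace ℝ (Fin p)) M]
    (f : M → Sph p × X₂) (Λ : ℝ) : Prop :=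
  ∀ (m : M) (u : TangentSpace (𝓡 p) m),
    √(g₂ (f m).2 (mfderiv (𝓡 p) (𝓡 n) (fun q ↦ (f q).2) m u)
        (mfderiv (𝓡 p) (𝓡 n) (fun q ↦ (f q).2) m u))
      ≤ Λ * √(inducedMetric (𝓡 p) (ambientMetric p g₂) f m u u)

end

/-! When `Λ = 0`, the tangent spaces of `M` are those of the sphere factor and the normal spaces are
those of `X₂`. The curvature components in Simons' term are then those of constant curvature `κ =
1/(2(p-1))` on tangent vectors, and zero for the mixed ones. For trace-free `A` this gives `R(A) =
κ(2(p-1) + 2) A = (1 + 1/(p-1)) A` (`simonsComponent_constantCurvature`). The sphere factor has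
Ricci curvature `(p-1)κ = 1/2`, so `ρ ≤ 1/2` and the leading constant `2ρ + 1/(p-1)` is at most this
eigenvalue.

The general case is a perturbation of this one. The `X₂`-part of a unit tangent vector has squared
length at most `δ = min(Λ², 1)`. The sphere part of the metric has trace `p` in any orthonormal
frame (`sum_sphereForm`), so the `p` tangent vectors, each taking at least `1 - δ`, leave at most
`pδ` to the normal ones. Every curvature component that occurs has at least two tangent arguments,
and is a combination of products of two sphere inner products plus a component of the curvature of
`X₂`; it differs from the model by `O(δ)` (`loweredCurvature_adaptedFrame`). As Simons' term is
linear in the curvature and in `A`, pairing it with `A` costs at most a constant times `δ‖A‖²`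
(`sum_simonsComponent_ge`).

The constant must be uniform over `X₂`, which needs a bound on its curvature. The function `|R|²` is
smooth and invariant under isometries. The symmetry at `x` acts by `-1` on the tangent space, so the
differential of `|R|²` vanishes at `x`; by connectedness `|R|²` is constant (`curvatureNormSq_eq`),
and it controls all values of the tensor (`abs_trilinear_le`).

The computations concern metrics on open subsets of a vector space: `curvature g x` unfolds to
`flatCurvature` of `chartMetric g x`. Naturality under local isometries removes the dependence on
the chart, and stereographic coordinates give the curvature of the sphere. -/

noncomputable section

/-! ### Christoffel symbols and curvature of a metric on an open subset of a vector space. -/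

section Flat

variable {E : Type*} [NormedAddCommGroup E] [NormedSpace ℝ E]

/-- The Christoffel symbols of the first kind of a metric on an open subset of a vector space. -/
def flatChristoffelFirst (h : E → E →L[ℝ] E →L[ℝ] ℝ) (y : E) : E →L[ℝ] E →L[ℝ] (E →L[ℝ] ℝ) :=
  let D : E →L[ℝ] E →L[ℝ] E →L[ℝ] ℝ := fderiv ℝ h y
  (1 / 2 : ℝ) • (D + D.flip
    - ((ContinuousLinearMap.flipₗᵢ ℝ E E ℝ).toContinuousLinearEquiv :
        (E →L[ℝ] E →L[ℝ] ℝ) →L[ℝ] (E →L[ℝ] E →L[ℝ] ℝ)) ∘L D.flip)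

/-- The Christoffel symbols of a metric on an open subset of a vector space. -/
def flatChristoffel (h : E → E →L[ℝ] E →L[ℝ] ℝ) (y : E) : E →L[ℝ] E →L[ℝ] E :=
  (ContinuousLinearMap.compL ℝ E (E →L[ℝ] ℝ) E (h y).inverse) ∘L (flatChristoffelFirst h y)

/-- The curvature tensor of a metric on an open subset of a vector space. -/
def flatCurvature (h : E → E →L[ℝ] E →L[ℝ] ℝ) (y u v w : E) : E :=
  fderiv ℝ (flatChristoffel h) y u v w - fderiv ℝ (flatChristoffel h) y v u w
    + flatChristoffel h y u (flatChristoffel h y v w)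
    - flatChristoffel h y v (flatChristoffel h y u w)

/-- `h` is a smooth Riemannian metric on the open set `U`. -/
structure IsFlatMetricOn (h : E → E →L[ℝ] E →L[ℝ] ℝ) (U : Set E) : Prop where
  isOpen : IsOpen U
  contDiffOn : ContDiffOn ℝ ∞ h U
  symm : ∀ y ∈ U, ∀ u v, h y u v = h y v u
  pos : ∀ y ∈ U, ∀ u, u ≠ 0 → 0 < h y u u

theorem HasFDerivAt.clm_apply_vec {F G : Type*} [NormedAddCommGroup F] [NormedSpace ℝ F]
    [NormedAddCommGroup G] [NormedSpace ℝ G] {f : E → F →L[ℝ] G} {f' : E →L[ℝ] F →L[ℝ] G} {y : E}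
    (hf : HasFDerivAt f f' y) (u : F) : HasFDerivAt (fun z ↦ f z u) (f'.flip u) y :=
  (ContinuousLinearMap.apply ℝ G u).hasFDerivAt.comp y hf

/-- A positive definite form is nondegenerate. -/
theorem eq_of_form_eq {b : E →L[ℝ] E →L[ℝ] ℝ} (pos : ∀ u, u ≠ 0 → 0 < b u u) {x y : E}
    (hxy : ∀ w, b x w = b y w) : x = y := by
  by_contra hne
  have := pos (x - y) (sub_ne_zero.2 hne)
  have h0 : b (x - y) (x - y) = b x (x - y) - b y (x - y) := by simp
  rw [h0, hxy, sub_self] at this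
  exact lt_irrefl _ this

/-- `ContinuousLinearMap.inverse` has the junk value zero off the invertible maps; positivity is
what makes it raise indices. -/
theorem isInvertible_of_pos [FiniteDimensional ℝ E] {b : E →L[ℝ] E →L[ℝ] ℝ}
    (pos : ∀ u, u ≠ 0 → 0 < b u u) : b.IsInvertible := by
  have inj : Function.Injective (b : E →ₗ[ℝ] (E →L[ℝ] ℝ)) := fun x y hxy ↦
    eq_of_form_eq pos fun w ↦ by
      have := congrArg (fun l : E →L[ℝ] ℝ ↦ l w) hxy
      exact this
  have hf : finrank ℝ E = finrank ℝ (E →L[ℝ] ℝ) := by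
    rw [← Subspace.dual_finrank_eq (K := ℝ) (V := E)]
    exact (LinearMap.toContinuousLinearMap (𝕜 := ℝ) (E := E) (F' := ℝ)).finrank_eq
  refine ⟨(LinearEquiv.ofInjectiveOfFinrankEq _ inj hf).toContinuousLinearEquiv, ?_⟩
  ext x y
  rfl

theorem flatChristoffelFirst_apply (h : E → E →L[ℝ] E →L[ℝ] ℝ) (y u v w : E) :
    flatChristoffelFirst h y u v w =
      (1 / 2 : ℝ) * (fderiv ℝ h y u v w + fderiv ℝ h y v u w - fderiv ℝ h y w u v) := by
  simp [flatChristoffelFirst]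

theorem flatChristoffel_form [FiniteDimensional ℝ E] {h : E → E →L[ℝ] E →L[ℝ] ℝ} {y : E}
    (pos : ∀ u, u ≠ 0 → 0 < h y u u) (u v w : E) :
    h y (flatChristoffel h y u v) w = flatChristoffelFirst h y u v w := by
  have : flatChristoffel h y u v = (h y).inverse (flatChristoffelFirst h y u v) := rfl
  rw [this, (isInvertible_of_pos pos).self_apply_inverse]

/-- Christoffel symbols are found below by proposing the vector and testing it against every `w`, so
that no inverse matrix is ever computed. -/
theorem flatChristoffel_eq [FiniteDimensional ℝ E] {h : E → E →L[ℝ] E →L[ℝ] ℝ} {y : E}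
    (pos : ∀ u, u ≠ 0 → 0 < h y u u) {u v z : E}
    (hz : ∀ w, h y z w = flatChristoffelFirst h y u v w) : flatChristoffel h y u v = z :=
  eq_of_form_eq pos fun w ↦ by rw [flatChristoffel_form pos, hz]

theorem flatChristoffelFirst_congr {h k : E → E →L[ℝ] E →L[ℝ] ℝ} {y : E}
    (hk : h =ᶠ[nhds y] k) : flatChristoffelFirst h y = flatChristoffelFirst k y := by
  simp only [flatChristoffelFirst, hk.fderiv_eq]

theorem flatChristoffel_congr {h k : E → E →L[ℝ] E →L[ℝ] ℝ} {y : E}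
    (hk : h =ᶠ[nhds y] k) : flatChristoffel h y = flatChristoffel k y := by
  simp only [flatChristoffel, flatChristoffelFirst_congr hk, hk.eq_of_nhds]

/-- Curvature depends only on the germ of the metric. This is needed for products, where the chart
metric is known to split on the chart domain only. -/
theorem flatCurvature_congr {h k : E → E →L[ℝ] E →L[ℝ] ℝ} {y : E}
    (hk : h =ᶠ[nhds y] k) : flatCurvature h y = flatCurvature k y := by
  have : flatChristoffel h =ᶠ[nhds y] flatChristoffel k :=
    hk.eventuallyEq_nhds.mono fun z hz ↦ flatChristoffel_congr hz
  ext u v w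
  simp only [flatCurvature, this.fderiv_eq, this.eq_of_nhds]

namespace IsFlatMetricOn

variable {h : E → E →L[ℝ] E →L[ℝ] ℝ} {U : Set E} (H : IsFlatMetricOn h U)
include H

theorem mono {V : Set E} (hV : IsOpen V) (hVU : V ⊆ U) : IsFlatMetricOn h V :=
  ⟨hV, H.contDiffOn.mono hVU, fun y hy ↦ H.symm y (hVU hy), fun y hy ↦ H.pos y (hVU hy)⟩

theorem contDiffAt {y : E} (hy : y ∈ U) : ContDiffAt ℝ ∞ h y :=
  H.contDiffOn.contDiffAt (H.isOpen.mem_nhds hy)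

theorem fderiv_symm {y : E} (hy : y ∈ U) (a u v : E) :
    fderiv ℝ h y a u v = fderiv ℝ h y a v u := by
  have hd : HasFDerivAt h (fderiv ℝ h y) y :=
    ((H.contDiffAt hy).differentiableAt (by simp)).hasFDerivAt
  have h1 : HasFDerivAt (fun z ↦ h z u v) _ y := (hd.clm_apply_vec u).clm_apply_vec v
  have h2 : HasFDerivAt (fun z ↦ h z v u) _ y := (hd.clm_apply_vec v).clm_apply_vec u
  have he : (fun z ↦ h z v u) =ᶠ[nhds y] fun z ↦ h z u v :=
    Filter.eventually_of_mem (H.isOpen.mem_nhds hy) fun z hz ↦ H.symm z hz v u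
  have := h1.unique (h2.congr_of_eventuallyEq he.symm)
  exact congrArg (fun l : E →L[ℝ] ℝ ↦ l a) this

theorem flatChristoffel_symm [FiniteDimensional ℝ E] {y : E} (hy : y ∈ U) (u v : E) :
    flatChristoffel h y u v = flatChristoffel h y v u := by
  apply flatChristoffel_eq (H.pos y hy)
  intro w
  rw [flatChristoffel_form (H.pos y hy), flatChristoffelFirst_apply, flatChristoffelFirst_apply,
    H.fderiv_symm hy w u v]
  ring

theorem contDiffOn_fderiv : ContDiffOn ℝ ∞ (fderiv ℝ h) U :=
  H.contDiffOn.fderiv_of_isOpen H.isOpen (by simp)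

theorem contDiffOn_flatChristoffelFirst : ContDiffOn ℝ ∞ (flatChristoffelFirst h) U := by
  have hD := H.contDiffOn_fderiv
  have hf : ContDiffOn ℝ ∞ (fun y ↦ (fderiv ℝ h y).flip) U :=
    (ContinuousLinearMap.flipₗᵢ ℝ E E (E →L[ℝ] ℝ)).toContinuousLinearEquiv.contDiff.comp_contDiffOn
      hD
  have hc : ContDiffOn ℝ ∞ (fun y ↦ ((ContinuousLinearMap.flipₗᵢ ℝ E E ℝ).toContinuousLinearEquiv :
        (E →L[ℝ] E →L[ℝ] ℝ) →L[ℝ] (E →L[ℝ] E →L[ℝ] ℝ)) ∘L (fderiv ℝ h y).flip) U :=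
    contDiffOn_const.clm_comp hf
  exact ((hD.add hf).sub hc).const_smul (1 / 2 : ℝ)

theorem contDiffOn_inverse [FiniteDimensional ℝ E] :
    ContDiffOn ℝ ∞ (fun y ↦ (h y).inverse) U := by
  have := FiniteDimensional.complete ℝ E
  intro y hy
  exact ((isInvertible_of_pos (H.pos y hy)).contDiffAt_map_inverse.comp y
    (H.contDiffAt hy)).contDiffWithinAt

theorem contDiffOn_flatChristoffel [FiniteDimensional ℝ E] :
    ContDiffOn ℝ ∞ (flatChristoffel h) U :=
  ((ContinuousLinearMap.compL ℝ E (E →L[ℝ] ℝ) E).contDiff.comp_contDiffOn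
    H.contDiffOn_inverse).clm_comp H.contDiffOn_flatChristoffelFirst

theorem contDiffOn_flatCurvature [FiniteDimensional ℝ E] {u v w : E → E}
    (hu : ContDiffOn ℝ ∞ u U) (hv : ContDiffOn ℝ ∞ v U) (hw : ContDiffOn ℝ ∞ w U) :
    ContDiffOn ℝ ∞ (fun y ↦ flatCurvature h y (u y) (v y) (w y)) U := by
  have hG := H.contDiffOn_flatChristoffel
  have hD : ContDiffOn ℝ ∞ (fderiv ℝ (flatChristoffel h)) U :=
    hG.fderiv_of_isOpen H.isOpen (by simp)
  exact (((((hD.clm_apply hu).clm_apply hv).clm_apply hw).sub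
    (((hD.clm_apply hv).clm_apply hu).clm_apply hw)).add
    ((hG.clm_apply hu).clm_apply ((hG.clm_apply hv).clm_apply hw))).sub
    ((hG.clm_apply hv).clm_apply ((hG.clm_apply hu).clm_apply hw))

end IsFlatMetricOn

end Flat

/-! ### Naturality of the curvature under local isometries. -/

section Naturality

variable {E : Type*} [NormedAddCommGroup E] [NormedSpace ℝ E]

/-- `ψ` is a smooth local isometry from `(U, h)` to `(V, k)`. -/
structure IsFlatIsometryOn (h k : E → E →L[ℝ] E →L[ℝ] ℝ) (U V : Set E) (ψ : E → E) : Prop where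
  source : IsFlatMetricOn h U
  target : IsFlatMetricOn k V
  contDiffOn : ContDiffOn ℝ ∞ ψ U
  mapsTo : Set.MapsTo ψ U V
  pullback : ∀ y ∈ U, ∀ u v, h y u v = k (ψ y) (fderiv ℝ ψ y u) (fderiv ℝ ψ y v)

namespace IsFlatIsometryOn

variable {h k : E → E →L[ℝ] E →L[ℝ] ℝ} {U V : Set E} {ψ : E → E}
  (S : IsFlatIsometryOn h k U V ψ)
include S

theorem contDiffAt {y : E} (hy : y ∈ U) : ContDiffAt ℝ ∞ ψ y :=
  S.contDiffOn.contDiffAt (S.source.isOpen.mem_nhds hy)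

theorem contDiffOn_fderiv : ContDiffOn ℝ ∞ (fderiv ℝ ψ) U :=
  S.contDiffOn.fderiv_of_isOpen S.source.isOpen (by simp)

theorem contDiffOn_fderiv_fderiv : ContDiffOn ℝ ∞ (fderiv ℝ (fderiv ℝ ψ)) U :=
  S.contDiffOn_fderiv.fderiv_of_isOpen S.source.isOpen (by simp)

theorem hasFDerivAt_fderiv {y : E} (hy : y ∈ U) :
    HasFDerivAt (fderiv ℝ ψ) (fderiv ℝ (fderiv ℝ ψ) y) y :=
  ((S.contDiffOn_fderiv.contDiffAt (S.source.isOpen.mem_nhds hy)).differentiableAt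
    (by simp)).hasFDerivAt

theorem snd_symm {y : E} (hy : y ∈ U) (u v : E) :
    fderiv ℝ (fderiv ℝ ψ) y u v = fderiv ℝ (fderiv ℝ ψ) y v u :=
  (S.contDiffAt hy).isSymmSndFDerivAt
    (by simpa using ENat.LEInfty.out) u v

theorem third_symm {y : E} (hy : y ∈ U) (u v w : E) :
    fderiv ℝ (fderiv ℝ (fderiv ℝ ψ)) y u v w = fderiv ℝ (fderiv ℝ (fderiv ℝ ψ)) y v u w :=
  congrArg (fun l : E →L[ℝ] E ↦ l w)
    ((S.contDiffOn_fderiv.contDiffAt (S.source.isOpen.mem_nhds hy)).isSymmSndFDerivAt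
      (by simpa using ENat.LEInfty.out) u v)

theorem fderiv_injective {y : E} (hy : y ∈ U) : Function.Injective (fderiv ℝ ψ y) := by
  rw [injective_iff_map_eq_zero]
  intro u hu
  by_contra hne
  have := S.source.pos y hy u hne
  rw [S.pullback y hy, hu] at this
  simp at this

theorem fderiv_surjective [FiniteDimensional ℝ E] {y : E} (hy : y ∈ U) :
    Function.Surjective (fderiv ℝ ψ y) :=
  LinearMap.injective_iff_surjective (f := (fderiv ℝ ψ y : E →ₗ[ℝ] E)).1 (S.fderiv_injective hy)

theorem fderiv_pullback {y : E} (hy : y ∈ U) (a u v : E) :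
    fderiv ℝ h y a u v =
      fderiv ℝ k (ψ y) (fderiv ℝ ψ y a) (fderiv ℝ ψ y u) (fderiv ℝ ψ y v)
      + k (ψ y) (fderiv ℝ (fderiv ℝ ψ) y a u) (fderiv ℝ ψ y v)
      + k (ψ y) (fderiv ℝ ψ y u) (fderiv ℝ (fderiv ℝ ψ) y a v) := by
  have hh : HasFDerivAt h (fderiv ℝ h y) y :=
    ((S.source.contDiffAt hy).differentiableAt (by simp)).hasFDerivAt
  have hk : HasFDerivAt k (fderiv ℝ k (ψ y)) (ψ y) :=
    ((S.target.contDiffAt (S.mapsTo hy)).differentiableAt (by simp)).hasFDerivAt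
  have hψ : HasFDerivAt ψ (fderiv ℝ ψ y) y :=
    ((S.contDiffAt hy).differentiableAt (by simp)).hasFDerivAt
  have hD := S.hasFDerivAt_fderiv hy
  have h1 := (hh.clm_apply_vec u).clm_apply_vec v
  have h2 := ((hk.comp y hψ).clm_apply (hD.clm_apply_vec u)).clm_apply (hD.clm_apply_vec v)
  have he : (fun z ↦ h z u v) =ᶠ[nhds y]
      fun z ↦ k (ψ z) (fderiv ℝ ψ z u) (fderiv ℝ ψ z v) :=
    Filter.eventually_of_mem (S.source.isOpen.mem_nhds hy) fun z hz ↦ S.pullback z hz u v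
  have := congrArg (fun l : E →L[ℝ] ℝ ↦ l a) (h1.unique (h2.congr_of_eventuallyEq he))
  simp at this
  rw [this]
  ring

/-- The transformation law of Christoffel symbols. As `dψ` is onto, it suffices to test against `dψ
w`. In the Koszul combination of the differentiated pullback identity, symmetry of `D²ψ` cancels the
terms with `D²ψ(u, w)` and `D²ψ(v, w)`, while the two terms with `D²ψ(u, v)` add up. -/
theorem flatChristoffel_map [FiniteDimensional ℝ E] {y : E} (hy : y ∈ U) (u v : E) :
    fderiv ℝ ψ y (flatChristoffel h y u v) = fderiv ℝ (fderiv ℝ ψ) y u v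
      + flatChristoffel k (ψ y) (fderiv ℝ ψ y u) (fderiv ℝ ψ y v) := by
  have hV := S.mapsTo hy
  apply eq_of_form_eq (S.target.pos _ hV)
  intro w'
  obtain ⟨w, rfl⟩ := S.fderiv_surjective hy w'
  rw [← S.pullback y hy, flatChristoffel_form (S.source.pos y hy), map_add, add_apply,
    flatChristoffel_form (S.target.pos _ hV), flatChristoffelFirst_apply,
    flatChristoffelFirst_apply, S.fderiv_pullback hy, S.fderiv_pullback hy, S.fderiv_pullback hy,
    S.target.symm _ hV (fderiv ℝ ψ y v) (fderiv ℝ (fderiv ℝ ψ) y u w),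
    S.target.symm _ hV (fderiv ℝ ψ y u) (fderiv ℝ (fderiv ℝ ψ) y v w),
    S.target.symm _ hV (fderiv ℝ ψ y u) (fderiv ℝ (fderiv ℝ ψ) y w v),
    S.snd_symm hy w u, S.snd_symm hy w v, S.snd_symm hy v u]
  ring

/-- The derivative of the transformation law in the direction `a`; the last term comes from
differentiating the factor `dψ` on the left side. -/
theorem fderiv_flatChristoffel_map [FiniteDimensional ℝ E] {y : E} (hy : y ∈ U) (a u v : E) :
    fderiv ℝ ψ y (fderiv ℝ (flatChristoffel h) y a u v) =
      fderiv ℝ (fderiv ℝ (fderiv ℝ ψ)) y a u v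
      + fderiv ℝ (flatChristoffel k) (ψ y) (fderiv ℝ ψ y a) (fderiv ℝ ψ y u) (fderiv ℝ ψ y v)
      + flatChristoffel k (ψ y) (fderiv ℝ (fderiv ℝ ψ) y a u) (fderiv ℝ ψ y v)
      + flatChristoffel k (ψ y) (fderiv ℝ ψ y u) (fderiv ℝ (fderiv ℝ ψ) y a v)
      - fderiv ℝ (fderiv ℝ ψ) y a (flatChristoffel h y u v) := by
  have hU := S.source.isOpen.mem_nhds hy
  have hh : HasFDerivAt (flatChristoffel h) (fderiv ℝ (flatChristoffel h) y) y :=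
    ((S.source.contDiffOn_flatChristoffel.contDiffAt hU).differentiableAt (by simp)).hasFDerivAt
  have hk : HasFDerivAt (flatChristoffel k) (fderiv ℝ (flatChristoffel k) (ψ y)) (ψ y) :=
    ((S.target.contDiffOn_flatChristoffel.contDiffAt
      (S.target.isOpen.mem_nhds (S.mapsTo hy))).differentiableAt (by simp)).hasFDerivAt
  have hψ : HasFDerivAt ψ (fderiv ℝ ψ y) y :=
    ((S.contDiffAt hy).differentiableAt (by simp)).hasFDerivAt
  have hD := S.hasFDerivAt_fderiv hy
  have hD2 : HasFDerivAt (fderiv ℝ (fderiv ℝ ψ)) (fderiv ℝ (fderiv ℝ (fderiv ℝ ψ)) y) y :=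
    ((S.contDiffOn_fderiv_fderiv.contDiffAt hU).differentiableAt (by simp)).hasFDerivAt
  have h1 := hD.clm_apply ((hh.clm_apply_vec u).clm_apply_vec v)
  have h2 := ((hD2.clm_apply_vec u).clm_apply_vec v).add
    (((hk.comp y hψ).clm_apply (hD.clm_apply_vec u)).clm_apply (hD.clm_apply_vec v))
  have he : (fun z ↦ fderiv ℝ ψ z (flatChristoffel h z u v)) =ᶠ[nhds y] _ :=
    Filter.eventually_of_mem hU fun z hz ↦ S.flatChristoffel_map hz u v
  have := congrArg (fun l : E →L[ℝ] E ↦ l a) (h1.unique (h2.congr_of_eventuallyEq he))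
  simp at this
  rw [← eq_sub_iff_add_eq] at this
  rw [this]
  abel

/-- The curvature tensor is natural under isometries. -/
theorem flatCurvature_map [FiniteDimensional ℝ E] {y : E} (hy : y ∈ U) (u v w : E) :
    fderiv ℝ ψ y (flatCurvature h y u v w) =
      flatCurvature k (ψ y) (fderiv ℝ ψ y u) (fderiv ℝ ψ y v) (fderiv ℝ ψ y w) := by
  simp only [flatCurvature, map_add, map_sub, S.fderiv_flatChristoffel_map hy,
    S.flatChristoffel_map hy]
  -- Antisymmetrisation in `u, v` removes `D³ψ`; the terms in `D²ψ` cancel between the derivative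
  -- part and the quadratic part of the curvature.
  rw [S.third_symm hy v u w, S.snd_symm hy v u]
  abel

end IsFlatIsometryOn

end Naturality

/-! ### The norm of a trilinear map in an arbitrary pair of dual bases, and the bound it gives. -/

section Tensor

variable {E : Type*} [NormedAddCommGroup E] [NormedSpace ℝ E]
  {ι ι' : Type*} [Fintype ι] [Fintype ι'] [DecidableEq ι] [DecidableEq ι']

/-- The families `c` and `d` are dual to each other for the form `b`. -/
structure IsDualPair (b : E →L[ℝ] E →L[ℝ] ℝ) (c d : ι → E) : Prop where
  card_eq : Fintype.card ι = finrank ℝ E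
  apply : ∀ i j, b (c i) (d j) = if i = j then 1 else 0

theorem IsDualPair.exists_basis [FiniteDimensional ℝ E] {b : E →L[ℝ] E →L[ℝ] ℝ} {c d : ι → E}
    (h : IsDualPair b c d) :
    ∃ B : Basis ι ℝ E, (∀ i, B i = c i) ∧ ∀ x i, B.repr x i = b x (d i) := by
  have key : ∀ (a : ι → ℝ) j, b (∑ i, a i • c i) (d j) = a j := fun a j ↦ by
    simp [sum_apply, h.apply]
  have li : LinearIndependent ℝ c := by
    rw [Fintype.linearIndependent_iff]
    intro a ha j
    rw [← key a j, ha]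
    simp
  let B := basisOfLinearIndependentOfCardEqFinrank' c li h.card_eq
  refine ⟨B, fun i ↦ by simp [B], fun x i ↦ ?_⟩
  have hx : ∑ i, B.repr x i • c i = x := by
    have := B.sum_repr x
    simpa [B] using this
  rw [← key (B.repr x) i, hx]

theorem IsDualPair.sum_left [FiniteDimensional ℝ E] {b : E →L[ℝ] E →L[ℝ] ℝ} {c d : ι → E}
    (h : IsDualPair b c d) (x : E) : ∑ i, b x (d i) • c i = x := by
  obtain ⟨B, hB, hr⟩ := h.exists_basis
  simp_rw [← hr, ← hB]
  exact B.sum_repr x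

theorem IsDualPair.trace_eq [FiniteDimensional ℝ E] {b : E →L[ℝ] E →L[ℝ] ℝ} {c d : ι → E}
    (h : IsDualPair b c d) (L : E →ₗ[ℝ] E) : LinearMap.trace ℝ E L = ∑ i, b (L (c i)) (d i) := by
  obtain ⟨B, hB, hr⟩ := h.exists_basis
  simp [LinearMap.trace_eq_matrix_trace ℝ B, Matrix.trace, LinearMap.toMatrix_apply, hr, hB]

theorem IsDualPair.flip {b : E →L[ℝ] E →L[ℝ] ℝ} {c d : ι → E} (h : IsDualPair b c d) :
    IsDualPair b.flip d c :=
  ⟨h.card_eq, fun i j ↦ by simp [h.apply, eq_comm]⟩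

theorem IsDualPair.sum_right [FiniteDimensional ℝ E] {b : E →L[ℝ] E →L[ℝ] ℝ} {c d : ι → E} (h : IsDualPair b c d)
    (x : E) :
    ∑ i, b (c i) x • d i = x :=
  h.flip.sum_left x

/-- The contraction of a bilinear map with a form does not depend on the dual pair used. -/
theorem IsDualPair.sum_eq {G : Type*} [AddCommGroup G] [Module ℝ G]
    [FiniteDimensional ℝ E] {b : E →L[ℝ] E →L[ℝ] ℝ}
    {c d : ι → E} {c' d' : ι' → E}
    (h : IsDualPair b c d) (h' : IsDualPair b c' d') {T : E → E → G}
    (T₁ : ∀ y, IsLinearMap ℝ (T · y)) (T₂ : ∀ x, IsLinearMap ℝ (T x)) :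
    ∑ i, T (c i) (d i) = ∑ i, T (c' i) (d' i) := by
  have e1 : ∀ i, T (c' i) (d' i) = ∑ j, b (c' i) (d j) • T (c j) (d' i) := fun i ↦ by
    have := congrArg ((T₁ (d' i)).mk') (h.sum_left (c' i))
    rw [map_sum] at this
    simpa using this.symm
  have e2 : ∀ j, T (c j) (d j) = ∑ i, b (c' i) (d j) • T (c j) (d' i) := fun j ↦ by
    have := congrArg ((T₂ (c j)).mk') (h'.sum_right (d j))
    rw [map_sum] at this
    simpa using this.symm
  simp_rw [e1, e2]
  exact Finset.sum_comm

/-- A map of three arguments that is linear in each of them. -/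
structure IsTrilinear (R : E → E → E → E) : Prop where
  fst : ∀ v w, IsLinearMap ℝ (R · v w)
  snd : ∀ u w, IsLinearMap ℝ (R u · w)
  trd : ∀ u v, IsLinearMap ℝ (R u v ·)

/-- The squared norm of a tensor, computed with a dual pair. -/
def tensorNormSq (b : E →L[ℝ] E →L[ℝ] ℝ) (c d : ι → E) (R : E → E → E → E) : ℝ :=
  ∑ i, ∑ j, ∑ k, b (R (c i) (c j) (c k)) (R (d i) (d j) (d k))

theorem IsTrilinear.comp_fst {R : E → E → E → E} (hR : IsTrilinear R) (l : E →L[ℝ] ℝ) (v w : E) :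
    IsLinearMap ℝ fun x ↦ l (R x v w) :=
  ⟨fun x y ↦ by rw [(hR.fst v w).map_add, map_add], fun x y ↦ by
    rw [(hR.fst v w).map_smul, map_smul]⟩

theorem IsTrilinear.comp_snd {R : E → E → E → E} (hR : IsTrilinear R) (l : E →L[ℝ] ℝ) (u w : E) :
    IsLinearMap ℝ fun x ↦ l (R u x w) :=
  ⟨fun x y ↦ by rw [(hR.snd u w).map_add, map_add], fun x y ↦ by
    rw [(hR.snd u w).map_smul, map_smul]⟩

theorem IsTrilinear.comp_trd {R : E → E → E → E} (hR : IsTrilinear R) (l : E →L[ℝ] ℝ) (u v : E) :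
    IsLinearMap ℝ fun x ↦ l (R u v x) :=
  ⟨fun x y ↦ by rw [(hR.trd u v).map_add, map_add], fun x y ↦ by
    rw [(hR.trd u v).map_smul, map_smul]⟩

omit [DecidableEq ι] in
theorem isLinearMap_sum {F : ι → E → ℝ} (h : ∀ i, IsLinearMap ℝ (F i)) :
    IsLinearMap ℝ fun x ↦ ∑ i, F i x :=
  ⟨fun x y ↦ by simp_rw [(h _).map_add, Finset.sum_add_distrib], fun a x ↦ by
    simp_rw [(h _).map_smul, Finset.smul_sum]⟩

/-- One pair of indices is changed at a time. Independence of the dual pair lets the same number be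
computed with a fixed basis and its dual (which vary smoothly with the point), with the image of
such a pair under an isometry, or with an orthonormal basis (where it is a sum of squares). -/
theorem tensorNormSq_eq [FiniteDimensional ℝ E] {b : E →L[ℝ] E →L[ℝ] ℝ}
    {R : E → E → E → E} (hR : IsTrilinear R)
    {c d : ι → E} {c' d' : ι' → E} (h : IsDualPair b c d) (h' : IsDualPair b c' d') :
    tensorNormSq b c d R = tensorNormSq b c' d' R := by
  unfold tensorNormSq
  have s1 : ∀ u u' v v', ∑ k, b (R u v (c k)) (R u' v' (d k)) =
      ∑ k, b (R u v (c' k)) (R u' v' (d' k)) := fun u u' v v' ↦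
    h.sum_eq h' (T := fun x y ↦ b (R u v x) (R u' v' y))
      (fun y ↦ hR.comp_trd (b.flip (R u' v' y)) u v) (fun x ↦ hR.comp_trd (b (R u v x)) u' v')
  simp_rw [s1]
  have s2 : ∀ u u', ∑ j, ∑ k, b (R u (c j) (c' k)) (R u' (d j) (d' k)) =
      ∑ j, ∑ k, b (R u (c' j) (c' k)) (R u' (d' j) (d' k)) := fun u u' ↦
    h.sum_eq h' (T := fun x y ↦ ∑ k, b (R u x (c' k)) (R u' y (d' k)))
      (fun y ↦ isLinearMap_sum fun k ↦ hR.comp_snd (b.flip (R u' y (d' k))) u (c' k))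
      (fun x ↦ isLinearMap_sum fun k ↦ hR.comp_snd (b (R u x (c' k))) u' (d' k))
  simp_rw [s2]
  exact h.sum_eq h' (T := fun x y ↦ ∑ j, ∑ k, b (R x (c' j) (c' k)) (R y (d' j) (d' k)))
      (fun y ↦ isLinearMap_sum fun j ↦ isLinearMap_sum fun k ↦
        hR.comp_fst (b.flip (R y (d' j) (d' k))) (c' j) (c' k))
      (fun x ↦ isLinearMap_sum fun j ↦ isLinearMap_sum fun k ↦
        hR.comp_fst (b (R x (c' j) (c' k))) (d' j) (d' k))

theorem form_sq_le {b : E →L[ℝ] E →L[ℝ] ℝ} (symm : ∀ u v, b u v = b v u)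
    (pos : ∀ u, u ≠ 0 → 0 < b u u) (x y : E) : b x y ^ 2 ≤ b x x * b y y := by
  have nn : ∀ u, 0 ≤ b u u := fun u ↦ by
    by_cases h : u = 0
    · simp [h]
    · exact (pos u h).le
  have := discrim_le_zero (a := b x x) (b := 2 * b x y) (c := b y y) fun t ↦ by
    have h := nn (t • x + y)
    simp [symm y x] at h
    linarith
  rw [discrim] at this
  linarith

theorem abs_form_le {b : E →L[ℝ] E →L[ℝ] ℝ} (symm : ∀ u v, b u v = b v u)
    (pos : ∀ u, u ≠ 0 → 0 < b u u) (x y : E) : |b x y| ≤ √(b x x) * √(b y y) := by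
  have nn : 0 ≤ b x x := by
    by_cases h : x = 0
    · simp [h]
    · exact (pos x h).le
  rw [← Real.sqrt_mul nn]
  exact Real.abs_le_sqrt (form_sq_le symm pos x y)

theorem exists_orthonormal_dualPair [FiniteDimensional ℝ E]
    {b : E →L[ℝ] E →L[ℝ] ℝ} (symm : ∀ u v, b u v = b v u)
    (pos : ∀ u, u ≠ 0 → 0 < b u u) : ∃ o : Fin (finrank ℝ E) → E, IsDualPair b o o := by
  let b' : LinearMap.BilinForm ℝ E := LinearMap.mk₂ ℝ (fun x y ↦ b x y) (by simp) (by simp)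
    (by simp) (by simp)
  have hs : LinearMap.IsSymm b' := ⟨fun x y ↦ symm x y⟩
  obtain ⟨v, hv⟩ := LinearMap.BilinForm.exists_orthogonal_basis (B := b') hs
  refine ⟨fun i ↦ (√(b (v i) (v i)))⁻¹ • v i, by simp, fun i j ↦ ?_⟩
  split_ifs with hij
  · subst hij
    have hp := pos (v i) (v.ne_zero i)
    have := Real.sq_sqrt hp.le
    have hs := Real.sqrt_pos.2 hp
    simp only [map_smul, smul_apply, smul_eq_mul]
    field_simp
    linarith
  · have : b (v i) (v j) = 0 := hv hij
    simp [this]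

/-- In an orthonormal basis `o` each vector `R(o i, o j, o k)` has length at most the norm of `R`,
and the coordinates of a vector are at most its length. The cube of the dimension counts the terms
of the expansion; a sharp constant is not needed. -/
theorem abs_trilinear_le [FiniteDimensional ℝ E]
    {b : E →L[ℝ] E →L[ℝ] ℝ} (symm : ∀ u v, b u v = b v u)
    (pos : ∀ u, u ≠ 0 → 0 < b u u) {R : E → E → E → E} (hR : IsTrilinear R)
    {c d : ι → E} (h : IsDualPair b c d) (u v w z : E) :
    |b (R u v w) z| ≤ (finrank ℝ E : ℝ) ^ 3 * √(tensorNormSq b c d R) *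
      (√(b u u) * √(b v v) * √(b w w) * √(b z z)) := by
  obtain ⟨o, ho⟩ := exists_orthonormal_dualPair symm pos
  rw [tensorNormSq_eq hR h ho]
  have nn : ∀ u, 0 ≤ b u u := fun u ↦ by
    by_cases h : u = 0
    · simp [h]
    · exact (pos u h).le
  have hcoef : ∀ x i, |b x (o i)| ≤ √(b x x) := fun x i ↦ by
    have := abs_form_le symm pos x (o i)
    rwa [ho.apply, if_pos rfl, Real.sqrt_one, mul_one] at this
  have hcomp : ∀ i j k, |b (R (o i) (o j) (o k)) z| ≤ √(tensorNormSq b o o R) * √(b z z) :=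
    fun i j k ↦ by
      refine (abs_form_le symm pos _ _).trans ?_
      gcongr
      unfold tensorNormSq
      have h3 := Finset.single_le_sum (f := fun k ↦ b (R (o i) (o j) (o k)) (R (o i) (o j) (o k)))
        (fun k _ ↦ nn _) (Finset.mem_univ k)
      have h2 := Finset.single_le_sum
        (f := fun j ↦ ∑ k, b (R (o i) (o j) (o k)) (R (o i) (o j) (o k)))
        (fun j _ ↦ Finset.sum_nonneg fun k _ ↦ nn _) (Finset.mem_univ j)
      have h1 := Finset.single_le_sum
        (f := fun i ↦ ∑ j, ∑ k, b (R (o i) (o j) (o k)) (R (o i) (o j) (o k)))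
        (fun i _ ↦ Finset.sum_nonneg fun j _ ↦ Finset.sum_nonneg fun k _ ↦ nn _)
        (Finset.mem_univ i)
      exact h3.trans (h2.trans h1)
  have expand : b (R u v w) z = ∑ i, ∑ j, ∑ k,
      b u (o i) * (b v (o j) * (b w (o k) * b (R (o i) (o j) (o k)) z)) := by
    have e1 : ∀ v w, b (R u v w) z = ∑ i, b u (o i) * b (R (o i) v w) z := fun v w ↦ by
      have := congrArg ((hR.comp_fst (b.flip z) v w).mk') (ho.sum_left u)
      rw [map_sum] at this
      simpa using this.symm
    have e2 : ∀ u w, b (R u v w) z = ∑ i, b v (o i) * b (R u (o i) w) z := fun u w ↦ by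
      have := congrArg ((hR.comp_snd (b.flip z) u w).mk') (ho.sum_left v)
      rw [map_sum] at this
      simpa using this.symm
    have e3 : ∀ u v, b (R u v w) z = ∑ i, b w (o i) * b (R u v (o i)) z := fun u v ↦ by
      have := congrArg ((hR.comp_trd (b.flip z) u v).mk') (ho.sum_left w)
      rw [map_sum] at this
      simpa using this.symm
    rw [e1]
    refine Finset.sum_congr rfl fun i _ ↦ ?_
    rw [e2, Finset.mul_sum]
    refine Finset.sum_congr rfl fun j _ ↦ ?_
    rw [e3, Finset.mul_sum, Finset.mul_sum]
  rw [expand]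
  calc |∑ i, ∑ j, ∑ k, b u (o i) * (b v (o j) * (b w (o k) * b (R (o i) (o j) (o k)) z))|
      ≤ ∑ i : Fin (finrank ℝ E), ∑ j : Fin (finrank ℝ E), ∑ k : Fin (finrank ℝ E),
        √(b u u) * (√(b v v) * (√(b w w) * (√(tensorNormSq b o o R) * √(b z z)))) := by
        refine (Finset.abs_sum_le_sum_abs _ _).trans (Finset.sum_le_sum fun i _ ↦ ?_)
        refine (Finset.abs_sum_le_sum_abs _ _).trans (Finset.sum_le_sum fun j _ ↦ ?_)
        refine (Finset.abs_sum_le_sum_abs _ _).trans (Finset.sum_le_sum fun k _ ↦ ?_)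
        rw [abs_mul, abs_mul, abs_mul]
        gcongr
        · exact hcoef u i
        · exact hcoef v j
        · exact hcoef w k
        · exact hcomp i j k
    _ = _ := by
        simp
        ring

omit [DecidableEq ι] in
theorem tensorNormSq_map {E' : Type*} [NormedAddCommGroup E'] [NormedSpace ℝ E']
    {b : E →L[ℝ] E →L[ℝ] ℝ} {b' : E' →L[ℝ] E' →L[ℝ] ℝ}
    {R : E → E → E → E} {R' : E' → E' → E' → E'} {L : E → E'} (hL : ∀ x y, b x y = b' (L x) (L y))
    (hR : ∀ u v w, L (R u v w) = R' (L u) (L v) (L w)) (c d : ι → E) :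
    tensorNormSq b c d R = tensorNormSq b' (L ∘ c) (L ∘ d) R' := by
  simp [tensorNormSq, hL, hR]

theorem isTrilinear_flatCurvature (h : E → E →L[ℝ] E →L[ℝ] ℝ) (y : E) :
    IsTrilinear (flatCurvature h y) := by
  refine ⟨fun v w ↦ ⟨?_, ?_⟩, fun u w ↦ ⟨?_, ?_⟩, fun u v ↦ ⟨?_, ?_⟩⟩ <;> intros <;>
    simp only [flatCurvature, map_add, map_smul, add_apply, smul_apply, smul_sub, smul_add] <;>
    abel

variable [FiniteDimensional ℝ E]

/-- The family dual to a basis, for the metric `h y`. -/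
def dualFamily (h : E → E →L[ℝ] E →L[ℝ] ℝ) (y : E) (i : Fin (finrank ℝ E)) : E :=
  (h y).inverse (LinearMap.toContinuousLinearMap ((finBasis ℝ E).coord i))

/-- The squared norm of the curvature tensor of a metric on an open subset of a vector space. -/
def flatCurvatureNormSq (h : E → E →L[ℝ] E →L[ℝ] ℝ) (y : E) : ℝ :=
  tensorNormSq (h y) (finBasis ℝ E) (dualFamily h y) (flatCurvature h y)

variable {h k : E → E →L[ℝ] E →L[ℝ] ℝ} {U V : Set E} {ψ : E → E}

theorem IsFlatMetricOn.isDualPair (H : IsFlatMetricOn h U) {y : E} (hy : y ∈ U) :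
    IsDualPair (h y) (finBasis ℝ E) (dualFamily h y) := by
  refine ⟨by simp, fun i j ↦ ?_⟩
  rw [H.symm y hy, dualFamily, (isInvertible_of_pos (H.pos y hy)).self_apply_inverse]
  simp [Finsupp.single_apply]

theorem IsFlatMetricOn.contDiffOn_flatCurvatureNormSq (H : IsFlatMetricOn h U) :
    ContDiffOn ℝ ∞ (flatCurvatureNormSq h) U := by
  have hd : ∀ i, ContDiffOn ℝ ∞ (fun y ↦ dualFamily h y i) U := fun i ↦
    H.contDiffOn_inverse.clm_apply contDiffOn_const
  unfold flatCurvatureNormSq tensorNormSq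
  refine ContDiffOn.sum fun i _ ↦ ContDiffOn.sum fun j _ ↦ ContDiffOn.sum fun k _ ↦ ?_
  exact (H.contDiffOn.clm_apply (H.contDiffOn_flatCurvature contDiffOn_const contDiffOn_const
    contDiffOn_const)).clm_apply (H.contDiffOn_flatCurvature (hd i) (hd j) (hd k))

/-- The differential of `ψ` carries the dual pair at `y` to a dual pair at `ψ y`. It need not be the
standard one there, which `tensorNormSq_eq` allows. -/
theorem IsFlatIsometryOn.flatCurvatureNormSq_eq (S : IsFlatIsometryOn h k U V ψ) {y : E}
    (hy : y ∈ U) : flatCurvatureNormSq h y = flatCurvatureNormSq k (ψ y) := by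
  have hd := S.source.isDualPair hy
  unfold flatCurvatureNormSq
  rw [tensorNormSq_map (S.pullback y hy) (S.flatCurvature_map hy)]
  refine tensorNormSq_eq (isTrilinear_flatCurvature k (ψ y)) ⟨hd.card_eq, fun i j ↦ ?_⟩
    (S.target.isDualPair (S.mapsTo hy))
  rw [← hd.apply, S.pullback y hy]
  rfl

end Tensor

/-! ### A Riemannian metric read in a chart. -/

section ChartMetric

variable {E : Type*} [NormedAddCommGroup E] [NormedSpace ℝ E]
  {H : Type*} [TopologicalSpace H] {I : ModelWithCorners ℝ E H} [I.Boundaryless]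
  {X : Type*} [TopologicalSpace X] [ChartedSpace H X] [IsManifold I ∞ X]

/-- Coordinate vector fields are smooth sections; evaluating the metric on them turns its smoothness
as a bundle section into smoothness of its coefficients. -/
theorem contMDiffOn_section_chartSymm (x : X) (u : E) :
    ContMDiffOn 𝓘(ℝ, E) I.tangent ∞
      (fun y : E ↦ (⟨(extChartAt I x).symm y,
        mfderiv 𝓘(ℝ, E) I (extChartAt I x).symm y u⟩ : TangentBundle I X))
      (extChartAt I x).target := by
  have ho := isOpen_extChartAt_target (I := I) x
  have h1 := (contMDiffOn_extChartAt_symm (I := I) (n := ∞) x).contMDiffOn_tangentMapWithin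
    (m := ∞) (by simp) ho.uniqueMDiffOn
  have h2 : ContMDiff 𝓘(ℝ, E) 𝓘(ℝ, E).tangent ∞
      (fun y : E ↦ (⟨y, u⟩ : TangentBundle 𝓘(ℝ, E) E)) := by
    intro y
    exact contMDiffAt_vectorSpace_iff_contDiffAt.2 contDiffAt_const
  refine (h1.comp h2.contMDiffOn fun y hy ↦ hy).congr fun y hy ↦ ?_
  have h3 : mfderivWithin 𝓘(ℝ, E) I (extChartAt I x).symm (extChartAt I x).target y =
      mfderiv 𝓘(ℝ, E) I (extChartAt I x).symm y := mfderivWithin_of_isOpen ho hy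
  simp only [Function.comp_apply, tangentMapWithin]
  rw [h3]

theorem isInvertible_mfderiv_chartSymm {x : X} {y : E} (hy : y ∈ (extChartAt I x).target) :
    (mfderiv 𝓘(ℝ, E) I (extChartAt I x).symm y : E →L[ℝ] E).IsInvertible := by
  have := isInvertible_mfderivWithin_extChartAt_symm (I := I) (x := x) hy
  rwa [I.range_eq_univ, mfderivWithin_univ] at this

omit [I.Boundaryless] [IsManifold I ∞ X] in
theorem chartMetric_apply (g : MetricField I X) (x : X) (y u v : E) :
    chartMetric g x y u v = g ((extChartAt I x).symm y)
      (mfderiv 𝓘(ℝ, E) I (extChartAt I x).symm y u)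
      (mfderiv 𝓘(ℝ, E) I (extChartAt I x).symm y v) := rfl

theorem contDiffOn_chartMetric_apply
    (g : Bundle.ContMDiffRiemannianMetric I ∞ E (TangentSpace I : X → Type _)) (x : X) (u v : E) :
    ContDiffOn ℝ ∞ (fun y ↦ chartMetric (I := I) g.inner x y u v) (extChartAt I x).target := by
  intro y hy
  have ho := isOpen_extChartAt_target (I := I) x
  have hs : ContMDiffAt 𝓘(ℝ, E) I ∞ (extChartAt I x).symm y :=
    (contMDiffOn_extChartAt_symm (I := I) (n := ∞) x).contMDiffAt (ho.mem_nhds hy)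
  have hu := (contMDiffOn_section_chartSymm (I := I) x u).contMDiffAt (ho.mem_nhds hy)
  have hv := (contMDiffOn_section_chartSymm (I := I) x v).contMDiffAt (ho.mem_nhds hy)
  have hg := (g.contMDiff ((extChartAt I x).symm y)).comp y hs
  have h := ContMDiffAt.clm_bundle_apply₂ (E₁ := (TangentSpace I : X → Type _))
    (E₂ := (TangentSpace I : X → Type _)) (F₁ := E) (F₂ := E)
    (E₃ := Bundle.Trivial X ℝ) (F₃ := ℝ) hg hu hv
  rw [Bundle.contMDiffAt_totalSpace] at h
  exact (contMDiffAt_iff_contDiffAt.1 h.2).contDiffWithinAt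

theorem isFlatMetricOn_chartMetric [FiniteDimensional ℝ E]
    (g : Bundle.ContMDiffRiemannianMetric I ∞ E (TangentSpace I : X → Type _)) (x : X) :
    IsFlatMetricOn (chartMetric (I := I) g.inner x) (extChartAt I x).target := by
  refine ⟨isOpen_extChartAt_target x, ?_, fun y _ u v ↦ g.symm _ _ _, fun y hy u hu ↦ ?_⟩
  · rw [contDiffOn_clm_apply]
    intro u
    rw [contDiffOn_clm_apply]
    intro v
    exact contDiffOn_chartMetric_apply g x u v
  · rw [chartMetric_apply]
    refine g.pos _ _ fun h0 ↦ hu ?_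
    have hi := (isInvertible_mfderiv_chartSymm hy).injective
    exact hi (h0.trans (map_zero (mfderiv 𝓘(ℝ, E) I (extChartAt I x).symm y : E →L[ℝ] E)).symm)

end ChartMetric

/-! ### Geodesic symmetries force the curvature to be bounded. -/

section Transition

variable {E : Type*} [NormedAddCommGroup E] [NormedSpace ℝ E] [FiniteDimensional ℝ E]
  {H : Type*} [TopologicalSpace H] {I : ModelWithCorners ℝ E H} [I.Boundaryless]
  {X : Type*} [TopologicalSpace X] [ChartedSpace H X] [IsManifold I ∞ X]

/-- A smooth map that preserves the metric is an isometry between the chart metrics. -/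
theorem isFlatIsometryOn_chart
    (g : Bundle.ContMDiffRiemannianMetric I ∞ E (TangentSpace I : X → Type _))
    {τ : X → X} (hτ : ContMDiff I I ∞ τ)
    (iso : ∀ (x : X) (v w : TangentSpace I x),
      g.inner (τ x) (mfderiv I I τ x v) (mfderiv I I τ x w) = g.inner x v w) (a b : X) :
    IsFlatIsometryOn (chartMetric (I := I) g.inner a) (chartMetric (I := I) g.inner b)
      ((extChartAt I a).target ∩
        (extChartAt I a).symm ⁻¹' (τ ⁻¹' (extChartAt I b).source)) (extChartAt I b).target
      (extChartAt I b ∘ τ ∘ (extChartAt I a).symm) := by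
  have hoa := isOpen_extChartAt_target (I := I) a
  have hsa : ∀ y ∈ (extChartAt I a).target, ContMDiffAt 𝓘(ℝ, E) I ∞ (extChartAt I a).symm y :=
    fun y hy ↦ (contMDiffOn_extChartAt_symm (I := I) (n := ∞) a).contMDiffAt (hoa.mem_nhds hy)
  have hsb : ∀ y ∈ (extChartAt I b).target, ContMDiffAt 𝓘(ℝ, E) I ∞ (extChartAt I b).symm y :=
    fun y hy ↦ (contMDiffOn_extChartAt_symm (I := I) (n := ∞) b).contMDiffAt
      ((isOpen_extChartAt_target (I := I) b).mem_nhds hy)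
  have hoU : IsOpen ((extChartAt I a).target ∩
        (extChartAt I a).symm ⁻¹' (τ ⁻¹' (extChartAt I b).source)) :=
    (continuousOn_extChartAt_symm a).isOpen_inter_preimage hoa
      ((isOpen_extChartAt_source b).preimage hτ.continuous)
  have hψ : ∀ y ∈ (extChartAt I a).target ∩
        (extChartAt I a).symm ⁻¹' (τ ⁻¹' (extChartAt I b).source),
      ContDiffAt ℝ ∞ (extChartAt I b ∘ τ ∘ (extChartAt I a).symm) y := fun y hy ↦ by
    apply ContMDiffAt.contDiffAt
    refine ContMDiffAt.comp (I' := I) y ?_ ((hτ _).comp y (hsa y hy.1))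
    apply contMDiffAt_extChartAt'
    have := hy.2
    simpa using this
  refine ⟨(isFlatMetricOn_chartMetric g a).mono hoU Set.inter_subset_left,
    isFlatMetricOn_chartMetric g b, fun y hy ↦ (hψ y hy).contDiffWithinAt,
    fun y hy ↦ (extChartAt I b).map_source hy.2, fun y hy u v ↦ ?_⟩
  set ψ := extChartAt I b ∘ τ ∘ (extChartAt I a).symm
  have hψy : ψ y ∈ (extChartAt I b).target := (extChartAt I b).map_source hy.2
  -- Off the chart domains the two maps may differ; agreement near `y` is enough for the chain rule.
  have heq : (extChartAt I b).symm ∘ ψ =ᶠ[nhds y] τ ∘ (extChartAt I a).symm :=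
    Filter.eventually_of_mem (hoU.mem_nhds hy) fun z hz ↦ (extChartAt I b).left_inv hz.2
  have hd : ∀ w : E, (mfderiv 𝓘(ℝ, E) I (extChartAt I b).symm (ψ y) (fderiv ℝ ψ y w) : E) =
      mfderiv I I τ ((extChartAt I a).symm y) (mfderiv 𝓘(ℝ, E) I (extChartAt I a).symm y w) := by
    intro w
    have e1 := mfderiv_comp (I' := 𝓘(ℝ, E)) y ((hsb _ hψy).mdifferentiableAt (by simp))
      ((hψ y hy).contMDiffAt.mdifferentiableAt (by simp))
    have e2 := mfderiv_comp (I' := I) y ((hτ _).mdifferentiableAt (by simp))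
      ((hsa y hy.1).mdifferentiableAt (by simp))
    have e3 := heq.mfderiv_eq (I := 𝓘(ℝ, E)) (I' := I)
    have e4 : (mfderiv 𝓘(ℝ, E) I ((extChartAt I b).symm ∘ ψ) y : E →L[ℝ] E) =
      mfderiv 𝓘(ℝ, E) I (τ ∘ (extChartAt I a).symm) y := e3
    have e5 := congrArg (fun l : E →L[ℝ] E ↦ l w) ((e1.symm.trans e4).trans e2)
    rw [mfderiv_eq_fderiv] at e5
    exact e5
  have hpt : (extChartAt I b).symm (ψ y) = τ ((extChartAt I a).symm y) := heq.eq_of_nhds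
  -- The base points agree only propositionally and the tangent spaces depend on them, so the point
  -- and both vectors are generalised before substitution.
  have key : ∀ (q : X) (hq : q = τ ((extChartAt I a).symm y)) (u' v' : E),
      u' = mfderiv I I τ ((extChartAt I a).symm y)
        (mfderiv 𝓘(ℝ, E) I (extChartAt I a).symm y u) →
      v' = mfderiv I I τ ((extChartAt I a).symm y)
        (mfderiv 𝓘(ℝ, E) I (extChartAt I a).symm y v) →
      MetricField.at (I := I) g.inner q u' v' = chartMetric (I := I) g.inner a y u v := by
    rintro q rfl u' v' rfl rfl
    exact iso _ _ _
  exact (key _ hpt _ _ (hd u) (hd v)).symm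

/-- The squared norm of the curvature tensor. -/
def curvatureNormSq (g : MetricField I X) (x : X) : ℝ :=
  flatCurvatureNormSq (chartMetric g x) (extChartAt I x x)

theorem curvatureNormSq_map
    (g : Bundle.ContMDiffRiemannianMetric I ∞ E (TangentSpace I : X → Type _))
    {τ : X → X} (hτ : ContMDiff I I ∞ τ)
    (iso : ∀ (x : X) (v w : TangentSpace I x),
      g.inner (τ x) (mfderiv I I τ x v) (mfderiv I I τ x w) = g.inner x v w) (x : X) :
    curvatureNormSq (I := I) g.inner (τ x) = curvatureNormSq (I := I) g.inner x := by
  have := (isFlatIsometryOn_chart g hτ iso x (τ x)).flatCurvatureNormSq_eq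
    (y := extChartAt I x x) ⟨mem_extChartAt_target x, by simp⟩
  rw [curvatureNormSq, curvatureNormSq, this]
  simp

/-- `curvatureNormSq` uses a chart that changes with the point, which hides its smoothness. The
identity is an isometry between the chart metrics at `x` and at `a`, so one fixed chart may be used
near `a`. -/
theorem curvatureNormSq_eq_chart
    (g : Bundle.ContMDiffRiemannianMetric I ∞ E (TangentSpace I : X → Type _)) (a : X) {x : X}
    (hx : x ∈ (extChartAt I a).source) :
    curvatureNormSq (I := I) g.inner x =
      flatCurvatureNormSq (chartMetric (I := I) g.inner a) (extChartAt I a x) := by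
  have := (isFlatIsometryOn_chart g (τ := id) contMDiff_id (by simp) x a).flatCurvatureNormSq_eq
    (y := extChartAt I x x) ⟨mem_extChartAt_target x, by simpa using hx⟩
  rw [curvatureNormSq, this]
  simp

theorem contMDiff_curvatureNormSq
    (g : Bundle.ContMDiffRiemannianMetric I ∞ E (TangentSpace I : X → Type _)) :
    ContMDiff I 𝓘(ℝ, ℝ) ∞ (curvatureNormSq (I := I) g.inner) := by
  intro x
  have h1 : ContMDiffAt 𝓘(ℝ, E) 𝓘(ℝ, ℝ) ∞
      (flatCurvatureNormSq (chartMetric (I := I) g.inner x)) (extChartAt I x x) :=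
    ((isFlatMetricOn_chartMetric g x).contDiffOn_flatCurvatureNormSq.contDiffAt
      ((isOpen_extChartAt_target x).mem_nhds (mem_extChartAt_target x))).contMDiffAt
  refine (h1.comp x contMDiffAt_extChartAt).congr_of_eventuallyEq ?_
  exact Filter.eventually_of_mem (extChartAt_source_mem_nhds (I := I) x) fun z hz ↦
    curvatureNormSq_eq_chart g x hz

omit [FiniteDimensional ℝ E] [I.Boundaryless] [IsManifold I ∞ X] in
/-- A smooth function that is invariant under a symmetry at `x` has zero derivative at `x`. -/
theorem mfderiv_eq_zero_of_symmetry {g : MetricField I X} {x : X} {σ : X ≃ₘ⟮I, I⟯ X}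
    (hσ : IsSymmetryAt g x σ) {f : X → ℝ} (hf : ContMDiff I 𝓘(ℝ, ℝ) ∞ f)
    (hinv : ∀ z, f (σ z) = f z) (v : E) : (mfderiv I 𝓘(ℝ, ℝ) f x v : ℝ) = 0 := by
  have h1 : HasMFDerivAt I 𝓘(ℝ, ℝ) f (σ x) (mfderiv I 𝓘(ℝ, ℝ) f (σ x)) :=
    ((hf _).mdifferentiableAt (by simp)).hasMFDerivAt
  have h2 : HasMFDerivAt I I σ x (mfderiv I I σ x) :=
    ((σ.contMDiff x).mdifferentiableAt (by simp)).hasMFDerivAt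
  have h3 := (h1.comp x h2).mfderiv
  have h4 : f ∘ σ = f := funext hinv
  have h5 : (mfderiv I 𝓘(ℝ, ℝ) (f ∘ σ) x : E →L[ℝ] ℝ) v =
      (mfderiv I 𝓘(ℝ, ℝ) f (σ x) : E →L[ℝ] ℝ) (mfderiv I I σ x v : E) :=
    congrArg (fun l : E →L[ℝ] ℝ ↦ l v) h3
  have hp : (mfderiv I 𝓘(ℝ, ℝ) f (σ x) : E →L[ℝ] ℝ) = (mfderiv I 𝓘(ℝ, ℝ) f x : E →L[ℝ] ℝ) := by
    rw [hσ.fixed]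
  -- The chain rule for `f ∘ σ = f` at the fixed point now says that `df v = df (-v)`.
  rw [hσ.derivative, hp, h4] at h5
  have h6 : (mfderiv I 𝓘(ℝ, ℝ) f x : E →L[ℝ] ℝ) (-v) = -(mfderiv I 𝓘(ℝ, ℝ) f x : E →L[ℝ] ℝ) v :=
    map_neg (mfderiv I 𝓘(ℝ, ℝ) f x : E →L[ℝ] ℝ) v
  have h7 : ∀ r : ℝ, r = -r → r = 0 := fun r hr ↦ by linarith
  exact h7 _ (h5.trans h6)

omit [FiniteDimensional ℝ E] in
theorem isLocallyConstant_of_mfderiv_eq_zero {f : X → ℝ} (hf : ContMDiff I 𝓘(ℝ, ℝ) ∞ f)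
    (h0 : ∀ (x : X) (v : E), (mfderiv I 𝓘(ℝ, ℝ) f x v : ℝ) = 0) : IsLocallyConstant f := by
  rw [IsLocallyConstant.iff_eventually_eq]
  intro x
  have ho := isOpen_extChartAt_target (I := I) x
  obtain ⟨r, hr, hball⟩ := Metric.isOpen_iff.1 ho _ (mem_extChartAt_target x)
  have hd : ∀ y ∈ (extChartAt I x).target,
      HasFDerivAt (f ∘ (extChartAt I x).symm) (0 : E →L[ℝ] ℝ) y := fun y hy ↦ by
    have h1 : HasMFDerivAt I 𝓘(ℝ, ℝ) f ((extChartAt I x).symm y) (0 : E →L[ℝ] ℝ) := by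
      have h2 : (mfderiv I 𝓘(ℝ, ℝ) f ((extChartAt I x).symm y) : E →L[ℝ] ℝ) = 0 := by
        ext v
        exact h0 _ v
      have h3 := ((hf ((extChartAt I x).symm y)).mdifferentiableAt (by simp)).hasMFDerivAt
      exact ⟨h3.1, h3.2.congr_fderiv h2⟩
    have h3 := ((contMDiffOn_extChartAt_symm (I := I) (n := ∞) x).contMDiffAt
      (ho.mem_nhds hy)).mdifferentiableAt (by simp) |>.hasMFDerivAt
    have h4 := h1.comp y h3
    rw [hasMFDerivAt_iff_hasFDerivAt] at h4
    refine h4.congr_fderiv ?_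
    ext v
    rfl
  have hc : ∀ y ∈ Metric.ball (extChartAt I x x) r, f ((extChartAt I x).symm y) = f x := by
    intro y hy
    have := (convex_ball (extChartAt I x x) r).is_const_of_fderivWithin_eq_zero (𝕜 := ℝ)
      (f := f ∘ (extChartAt I x).symm)
      (fun z hz ↦ (hd z (hball hz)).differentiableAt.differentiableWithinAt)
      (fun z hz ↦ by
        rw [fderivWithin_of_isOpen Metric.isOpen_ball hz, (hd z (hball hz)).fderiv])
      hy (Metric.mem_ball_self hr)
    simpa using this
  have hnear : ∀ᶠ z in nhds x, z ∈ (extChartAt I x).source ∧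
      extChartAt I x z ∈ Metric.ball (extChartAt I x x) r :=
    (Filter.eventually_of_mem (extChartAt_source_mem_nhds (I := I) x) fun z hz ↦ hz).and
      ((continuousAt_extChartAt (I := I) x).eventually (Metric.ball_mem_nhds _ hr))
  refine hnear.mono fun z hz ↦ ?_
  rw [← hc _ hz.2, (extChartAt I x).left_inv hz.1]

/-- The curvature tensor of a connected manifold with a geodesic symmetry at every point has
constant norm. -/
theorem curvatureNormSq_eq [PreconnectedSpace X]
    (g : Bundle.ContMDiffRiemannianMetric I ∞ E (TangentSpace I : X → Type _))
    (hσ : ∀ x, ∃ σ, IsSymmetryAt (I := I) g.inner x σ) (x y : X) :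
    curvatureNormSq (I := I) g.inner x = curvatureNormSq (I := I) g.inner y := by
  have hf := contMDiff_curvatureNormSq g
  refine (isLocallyConstant_of_mfderiv_eq_zero hf fun x v ↦ ?_).apply_eq_of_preconnectedSpace x y
  obtain ⟨σ, h⟩ := hσ x
  exact mfderiv_eq_zero_of_symmetry h hf
    (fun z ↦ curvatureNormSq_map g σ.contMDiff h.isometry z) v

omit [FiniteDimensional ℝ E] in
-- Tangent vectors at `x` are read in the preferred chart at `x`, whose inverse has the identity as
-- derivative at the base point.
theorem chartMetric_self (g : MetricField I X) (x : X) : chartMetric g x (extChartAt I x x) = g.at x := by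
  have h := mfderivWithin_range_extChartAt_symm (I := I) (x := x)
  rw [I.range_eq_univ, mfderivWithin_univ] at h
  ext u v
  simp only [chartMetric, h]
  rw [extChartAt_to_inv]
  rfl

/-- The curvature of a connected manifold with a geodesic symmetry at every point is bounded. -/
theorem exists_curvature_bound [ConnectedSpace X]
    (g : Bundle.ContMDiffRiemannianMetric I ∞ E (TangentSpace I : X → Type _))
    (hσ : ∀ x, ∃ σ, IsSymmetryAt (I := I) g.inner x σ) :
    ∃ K : ℝ, 0 ≤ K ∧ ∀ (x : X) (u v w z : E),
      |MetricField.at g.inner x (curvature (I := I) g.inner x u v w) z| ≤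
        K * (√(MetricField.at g.inner x u u) * √(MetricField.at g.inner x v v) *
          √(MetricField.at g.inner x w w) * √(MetricField.at g.inner x z z)) := by
  obtain ⟨x₀⟩ : Nonempty X := inferInstance
  refine ⟨(finrank ℝ E : ℝ) ^ 3 * √(curvatureNormSq (I := I) g.inner x₀), by positivity,
    fun x u v w z ↦ ?_⟩
  have H := isFlatMetricOn_chartMetric g x
  have hx := mem_extChartAt_target (I := I) x
  -- Constancy of the norm is what makes the bound, taken at `x₀`, valid at every `x`.
  rw [curvatureNormSq_eq g hσ x₀ x]
  have := abs_trilinear_le (H.symm _ hx) (H.pos _ hx)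
    (isTrilinear_flatCurvature (chartMetric (I := I) g.inner x) (extChartAt I x x))
    (H.isDualPair hx) u v w z
  rw [chartMetric_self] at this
  rw [curvatureNormSq, flatCurvatureNormSq, chartMetric_self]
  exact this

end Transition

/-! ### Curvature of the round metric in stereographic coordinates. -/

section Conformal

variable {E : Type*} [NormedAddCommGroup E] [InnerProductSpace ℝ E]

/-- The metric `c (|y|² + 4)⁻² ⟨·, ·⟩`: the round metric in stereographic coordinates. -/
def stereographicMetric (c : ℝ) (y : E) : E →L[ℝ] E →L[ℝ] ℝ :=
  (c * ((inner ℝ y y + 4) ^ 2)⁻¹) • innerSL ℝ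

theorem stereographicMetric_apply (c : ℝ) (y u v : E) :
    stereographicMetric c y u v = c * ((inner ℝ y y + 4) ^ 2)⁻¹ * inner ℝ u v := rfl

theorem inner_self_add_four_pos (y : E) : 0 < inner ℝ y y + 4 := by
  have := real_inner_self_nonneg (x := y)
  linarith

theorem hasFDerivAt_inner_self_add_four (y : E) :
    HasFDerivAt (fun y : E ↦ inner ℝ y y + 4) ((2 : ℝ) • innerSL ℝ y) y := by
  have h := ((hasFDerivAt_id y).inner ℝ (hasFDerivAt_id y)).add_const (4 : ℝ)
  refine h.congr_fderiv ?_
  ext a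
  simp [real_inner_comm, two_mul]

theorem isFlatMetricOn_stereographicMetric {c : ℝ} (hc : 0 < c) :
    IsFlatMetricOn (stereographicMetric c : E → E →L[ℝ] E →L[ℝ] ℝ) Set.univ where
  isOpen := isOpen_univ
  contDiffOn := by
    refine ContDiff.contDiffOn ?_
    unfold stereographicMetric
    have hq : ContDiff ℝ ∞ fun y : E ↦ (inner ℝ y y + 4) ^ 2 :=
      ((contDiff_id.inner ℝ contDiff_id).add contDiff_const).pow 2
    have hi : ContDiff ℝ ∞ fun y : E ↦ ((inner ℝ y y + 4) ^ 2)⁻¹ :=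
      hq.inv fun y ↦ pow_ne_zero 2 (inner_self_add_four_pos y).ne'
    exact (contDiff_const.mul hi).smul contDiff_const
  symm y _ u v := by rw [stereographicMetric_apply, stereographicMetric_apply, real_inner_comm v u]
  pos y _ u hu := by
    rw [stereographicMetric_apply]
    have := inner_self_add_four_pos y
    have := real_inner_self_pos.2 hu
    positivity

theorem fderiv_stereographicMetric (c : ℝ) (y a u v : E) :
    fderiv ℝ (stereographicMetric c) y a u v =
      -(4 * c * ((inner ℝ y y + 4) ^ 3)⁻¹ * inner ℝ y a * inner ℝ u v) := by
  have hq := (inner_self_add_four_pos y).ne'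
  have h := (((hasDerivAt_inv (pow_ne_zero 2 hq)).comp_hasFDerivAt y
    ((hasFDerivAt_inner_self_add_four y).pow 2)).const_mul c).smul_const (innerSL ℝ : E →L[ℝ] E →L[ℝ] ℝ)
  have h' : HasFDerivAt (stereographicMetric c) _ y := h
  rw [h'.fderiv]
  simp
  field_simp
  ring_nf
  rfl

/-- For a conformal factor `φ` of the Euclidean metric, `Γ(u, v)` is `(dφ(u) v + dφ(v) u - ⟨u, v⟩
grad φ) / (2φ)`. Here `dφ(a) / (2φ) = -2⟨y, a⟩ / (|y|² + 4)`, in which `c` has cancelled. -/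
theorem flatChristoffel_stereographicMetric [FiniteDimensional ℝ E] {c : ℝ} (hc : 0 < c)
    (y u v : E) : flatChristoffel (stereographicMetric c) y u v =
      (-2 * (inner ℝ y y + 4)⁻¹) • (inner ℝ y u • v + inner ℝ y v • u - inner ℝ u v • y) := by
  have hq := (inner_self_add_four_pos y).ne'
  apply flatChristoffel_eq ((isFlatMetricOn_stereographicMetric hc).pos y (Set.mem_univ y))
  intro w
  rw [flatChristoffelFirst_apply, fderiv_stereographicMetric, fderiv_stereographicMetric,
    fderiv_stereographicMetric, stereographicMetric_apply]
  simp only [inner_smul_left, inner_add_left, inner_sub_left, conj_trivial]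
  field_simp
  ring

/-- The symbols are a scalar times a vector `L y` linear in `y`. At the origin `L y` vanishes, so
only `L` is differentiated, and the scalar is `-2/4`. -/
theorem fderiv_flatChristoffel_stereographicMetric [FiniteDimensional ℝ E] {c : ℝ} (hc : 0 < c)
    (a u v : E) : fderiv ℝ (flatChristoffel (stereographicMetric c)) 0 a u v =
      (-1 / 2 : ℝ) • (inner ℝ a u • v + inner ℝ a v • u - inner ℝ u v • a) := by
  have hd : HasFDerivAt (flatChristoffel (stereographicMetric (E := E) c)) _ 0 :=
    ((((isFlatMetricOn_stereographicMetric hc).contDiffOn_flatChristoffel).contDiffAt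
      Filter.univ_mem).differentiableAt (by simp)).hasFDerivAt
  have h1 := (hd.clm_apply_vec u).clm_apply_vec v
  let L : E →L[ℝ] E := ((innerSL ℝ u).smulRight v + (innerSL ℝ v).smulRight u
    - inner ℝ u v • ContinuousLinearMap.id ℝ E)
  have h2 : HasFDerivAt (fun y : E ↦ (-2 * (inner ℝ y y + 4)⁻¹) • L y) _ 0 :=
    (((hasDerivAt_inv (inner_self_add_four_pos 0).ne').comp_hasFDerivAt 0
      (hasFDerivAt_inner_self_add_four (0 : E))).const_mul (-2 : ℝ)).smul L.hasFDerivAt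
  have he : (fun y ↦ flatChristoffel (stereographicMetric c) y u v) =
      fun y : E ↦ (-2 * (inner ℝ y y + 4)⁻¹) • L y := by
    ext1 y
    rw [flatChristoffel_stereographicMetric hc]
    simp [L, real_inner_comm]
  rw [he] at h1
  have := congrArg (fun l : E →L[ℝ] E ↦ l a) (h1.unique h2)
  simp at this
  rw [this]
  simp only [L]
  norm_num [real_inner_comm]

/-- At the origin the symbols vanish and only their derivatives count. The inner products are
Euclidean: the connection ignores the scale `c`, which enters the sectional curvature through the
metric alone. -/
theorem flatCurvature_stereographicMetric [FiniteDimensional ℝ E] {c : ℝ} (hc : 0 < c)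
    (u v w : E) : flatCurvature (stereographicMetric c) 0 u v w =
      inner ℝ v w • u - inner ℝ u w • v := by
  have h0 : ∀ a b : E, flatChristoffel (stereographicMetric c) 0 a b = 0 := fun a b ↦ by
    rw [flatChristoffel_stereographicMetric hc]
    simp
  rw [flatCurvature, fderiv_flatChristoffel_stereographicMetric hc,
    fderiv_flatChristoffel_stereographicMetric hc, h0, h0, real_inner_comm v u]
  module

end Conformal

/-! ### The metric of the sphere factor in its stereographic charts. -/

section Sphere

variable {p : ℕ}

theorem extChartAt_sphere_target (s : Sph p) : (extChartAt (𝓡 p) s).target = Set.univ := by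
  have := Fact.mk (@finrank_euclideanSpace_fin ℝ _ (p + 1))
  simp only [extChartAt, OpenPartialHomeomorph.extend_target]
  have : (chartAt (EuclideanSpace ℝ (Fin p)) s).target = Set.univ := stereographic'_target (-s)
  simp [this]

/-- The chart at `s` projects from `-s`, so `s` sits at the origin, the only point where the
curvature has been computed. -/
theorem extChartAt_sphere_self (s : Sph p) : extChartAt (𝓡 p) s s = 0 := by
  have := Fact.mk (@finrank_euclideanSpace_fin ℝ _ (p + 1))
  have h : (OrthonormalBasis.fromOrthogonalSpanSingleton p
    (ne_zero_of_mem_unit_sphere (-s))).repr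
      (stereographic (norm_eq_of_mem_sphere (-s)) s) = 0 := by
    rw [stereographic_neg_apply, map_zero]
  exact h

/-- Here `v` is the pole `-s` and `U` is the isometric inclusion of its orthogonal complement.
Writing `(|y|² - 4) / (|y|² + 4)` as `1 - 8 / (|y|² + 4)` leaves one scalar function to
differentiate. -/
theorem exists_sphere_chartSymm (s : Sph p) :
    ∃ (U : EuclideanSpace ℝ (Fin p) →ₗᵢ[ℝ] EuclideanSpace ℝ (Fin (p + 1)))
      (v : EuclideanSpace ℝ (Fin (p + 1))), inner ℝ v v = (1 : ℝ) ∧ (∀ y, inner ℝ (U y) v = (0 : ℝ)) ∧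
      ∀ y, ((extChartAt (𝓡 p) s).symm y : EuclideanSpace ℝ (Fin (p + 1))) =
        v + (inner ℝ y y + 4)⁻¹ • ((4 : ℝ) • U y - (8 : ℝ) • v) := by
  have := Fact.mk (@finrank_euclideanSpace_fin ℝ _ (p + 1))
  let U' := (OrthonormalBasis.fromOrthogonalSpanSingleton (𝕜 := ℝ) p
    (ne_zero_of_mem_unit_sphere (-s))).repr
  refine ⟨(Submodule.subtypeₗᵢ _).comp U'.symm.toLinearIsometry, -s, ?_, fun y ↦ ?_, fun y ↦ ?_⟩
  · simp
  · have := (U'.symm y).2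
    rw [Submodule.mem_orthogonal_singleton_iff_inner_left] at this
    exact this
  · have h := stereographic'_symm_apply (n := p) (-s) y
    have h2 : ((extChartAt (𝓡 p) s).symm y : EuclideanSpace ℝ (Fin (p + 1))) =
      ((stereographic' p (-s)).symm y : EuclideanSpace ℝ (Fin (p + 1))) := rfl
    rw [h2, h]
    have hn : ‖((U'.symm y : _) : EuclideanSpace ℝ (Fin (p + 1)))‖ ^ 2 = inner ℝ y y := by
      rw [real_inner_self_eq_norm_sq, ← U'.symm.norm_map y]
      rfl
    have hq := (inner_self_add_four_pos y).ne'
    change (‖((U'.symm y : _) : EuclideanSpace ℝ (Fin (p + 1)))‖ ^ 2 + 4)⁻¹ • (4 : ℝ) •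
      ((U'.symm y : _) : EuclideanSpace ℝ (Fin (p + 1))) +
      (‖((U'.symm y : _) : EuclideanSpace ℝ (Fin (p + 1)))‖ ^ 2 + 4)⁻¹ •
      (‖((U'.symm y : _) : EuclideanSpace ℝ (Fin (p + 1)))‖ ^ 2 - 4) •
        (-s : EuclideanSpace ℝ (Fin (p + 1))) =
      -s + (inner ℝ y y + 4)⁻¹ • ((4 : ℝ) • ((U'.symm y : _) : EuclideanSpace ℝ (Fin (p + 1)))
        - (8 : ℝ) • (-s : EuclideanSpace ℝ (Fin (p + 1))))
    rw [hn]
    match_scalars <;> field_simp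
    ring

/-- The inverse chart scales lengths by `4 / (|y|² + 4)`; the constant is `32 = 2 · 4²`, with the
normalisation `2(p-1)` of the metric. -/
theorem chartMetric_sphereMetric (s : Sph p) :
    chartMetric (sphereMetric p) s = stereographicMetric (32 * ((p : ℝ) - 1)) := by
  have := Fact.mk (@finrank_euclideanSpace_fin ℝ _ (p + 1))
  ext y u w
  obtain ⟨U, v, hv, hU, hφ⟩ := exists_sphere_chartSymm s
  have hq := (inner_self_add_four_pos y).ne'
  have hs : MDifferentiableAt 𝓘(ℝ, EuclideanSpace ℝ (Fin p)) (𝓡 p) (extChartAt (𝓡 p) s).symm y :=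
    ((contMDiffOn_extChartAt_symm (I := 𝓡 p) (n := ∞) s).contMDiffAt
      (by rw [extChartAt_sphere_target]; exact Filter.univ_mem)).mdifferentiableAt (by simp)
  have hc : MDifferentiableAt (𝓡 p) 𝓘(ℝ, EuclideanSpace ℝ (Fin (p + 1)))
      (fun q : Sph p ↦ (q : EuclideanSpace ℝ (Fin (p + 1)))) ((extChartAt (𝓡 p) s).symm y) :=
    (contMDiff_coe_sphere (m := ∞) _).mdifferentiableAt (by simp)
  have h1 := mfderiv_comp (I' := 𝓡 p) y hc hs
  have h2 : ((fun q : Sph p ↦ (q : EuclideanSpace ℝ (Fin (p + 1)))) ∘ (extChartAt (𝓡 p) s).symm)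
      = fun y ↦ v + (inner ℝ y y + 4)⁻¹ • ((4 : ℝ) • U y - (8 : ℝ) • v) := funext hφ
  have h3 : HasFDerivAt
      (fun y ↦ v + (inner ℝ y y + 4)⁻¹ • ((4 : ℝ) • U y - (8 : ℝ) • v)) _ y :=
    (((hasDerivAt_inv hq).comp_hasFDerivAt y (hasFDerivAt_inner_self_add_four y)).smul
      ((U.toContinuousLinearMap.hasFDerivAt.const_smul (4 : ℝ)).sub_const
        ((8 : ℝ) • v))).const_add v
  rw [h2, mfderiv_eq_fderiv, h3.fderiv] at h1
  have h4 : ∀ a : EuclideanSpace ℝ (Fin p),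
      (mfderiv (𝓡 p) 𝓘(ℝ, EuclideanSpace ℝ (Fin (p + 1)))
        (fun q : Sph p ↦ (q : EuclideanSpace ℝ (Fin (p + 1)))) ((extChartAt (𝓡 p) s).symm y)
        (mfderiv 𝓘(ℝ, EuclideanSpace ℝ (Fin p)) (𝓡 p) (extChartAt (𝓡 p) s).symm y a) :
          EuclideanSpace ℝ (Fin (p + 1))) =
      (4 * (inner ℝ y y + 4)⁻¹) • U a
        + (-2 * ((inner ℝ y y + 4) ^ 2)⁻¹ * inner ℝ y a) • ((4 : ℝ) • U y - (8 : ℝ) • v) := by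
    intro a
    refine (congrArg (fun l : EuclideanSpace ℝ (Fin p) →L[ℝ] EuclideanSpace ℝ (Fin (p + 1)) ↦ l a)
      h1).symm.trans ?_
    simp
    module
  have h5 : ∀ a b : EuclideanSpace ℝ (Fin (p + 1)),
      mfderiv (𝓡 p) 𝓘(ℝ, EuclideanSpace ℝ (Fin (p + 1)))
        (fun q : Sph p ↦ (q : EuclideanSpace ℝ (Fin (p + 1)))) ((extChartAt (𝓡 p) s).symm y)
        (mfderiv 𝓘(ℝ, EuclideanSpace ℝ (Fin p)) (𝓡 p) (extChartAt (𝓡 p) s).symm y u) = a →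
      mfderiv (𝓡 p) 𝓘(ℝ, EuclideanSpace ℝ (Fin (p + 1)))
        (fun q : Sph p ↦ (q : EuclideanSpace ℝ (Fin (p + 1)))) ((extChartAt (𝓡 p) s).symm y)
        (mfderiv 𝓘(ℝ, EuclideanSpace ℝ (Fin p)) (𝓡 p) (extChartAt (𝓡 p) s).symm y w) = b →
      chartMetric (sphereMetric p) s y u w = 2 * ((p : ℝ) - 1) * inner ℝ a b := by
    rintro _ _ rfl rfl
    rfl
  have hU' : ∀ y, inner ℝ v (U y) = (0 : ℝ) := fun y ↦ by rw [real_inner_comm, hU]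
  rw [h5 _ _ (h4 u) (h4 w), stereographicMetric_apply]
  simp only [inner_add_left, inner_add_right, inner_sub_left, inner_sub_right, inner_smul_left,
    inner_smul_right, conj_trivial, hv, hU, hU', LinearIsometry.inner_map_map]
  rw [real_inner_comm y u]
  field_simp
  ring

theorem sphereMetric_at (s : Sph p) (u v : EuclideanSpace ℝ (Fin p)) :
    (sphereMetric p).at s u v = 2 * ((p : ℝ) - 1) * inner ℝ u v := by
  rw [← chartMetric_self, chartMetric_sphereMetric, extChartAt_sphere_self,
    stereographicMetric_apply]
  rw [inner_zero_left]
  ring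

theorem isFlatMetricOn_chartMetric_sphereMetric (hp : 2 ≤ p) (s : Sph p) :
    IsFlatMetricOn (chartMetric (sphereMetric p) s) (extChartAt (𝓡 p) s).target := by
  rw [chartMetric_sphereMetric, extChartAt_sphere_target]
  have : (2 : ℝ) ≤ p := by exact_mod_cast hp
  exact isFlatMetricOn_stereographicMetric (by linarith)

theorem curvature_sphereMetric (hp : 2 ≤ p) (s : Sph p) (u v w : EuclideanSpace ℝ (Fin p)) :
    curvature (sphereMetric p) s u v w = inner ℝ v w • u - inner ℝ u w • v := by
  have : (2 : ℝ) ≤ p := by exact_mod_cast hp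
  have h : curvature (sphereMetric p) s u v w =
    flatCurvature (chartMetric (sphereMetric p) s) (extChartAt (𝓡 p) s s) u v w := rfl
  rw [h, chartMetric_sphereMetric, extChartAt_sphere_self,
    flatCurvature_stereographicMetric (by linarith)]

end Sphere

/-! ### Products of metrics on open subsets of vector spaces. -/

section FlatProduct

variable {E : Type*} [NormedAddCommGroup E] [NormedSpace ℝ E]
  {E' : Type*} [NormedAddCommGroup E'] [NormedSpace ℝ E']

/-- The product of metrics on open subsets of two vector spaces. -/
def flatProd (h : E → E →L[ℝ] E →L[ℝ] ℝ) (h' : E' → E' →L[ℝ] E' →L[ℝ] ℝ) (y : E × E') :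
    E × E' →L[ℝ] E × E' →L[ℝ] ℝ :=
  (h y.1).bilinearComp (ContinuousLinearMap.fst ℝ E E') (ContinuousLinearMap.fst ℝ E E')
    + (h' y.2).bilinearComp (ContinuousLinearMap.snd ℝ E E') (ContinuousLinearMap.snd ℝ E E')

variable {h : E → E →L[ℝ] E →L[ℝ] ℝ} {h' : E' → E' →L[ℝ] E' →L[ℝ] ℝ} {U : Set E} {U' : Set E'}

theorem flatProd_apply (y u v : E × E') :
    flatProd h h' y u v = h y.1 u.1 v.1 + h' y.2 u.2 v.2 := rfl

theorem IsFlatMetricOn.prod [FiniteDimensional ℝ E] [FiniteDimensional ℝ E']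
    (H : IsFlatMetricOn h U) (H' : IsFlatMetricOn h' U') :
    IsFlatMetricOn (flatProd h h') (U ×ˢ U') where
  isOpen := H.isOpen.prod H'.isOpen
  contDiffOn := by
    rw [contDiffOn_clm_apply]
    intro u
    rw [contDiffOn_clm_apply]
    intro v
    have h1 : ContDiffOn ℝ ∞ (fun y : E × E' ↦ h y.1) (U ×ˢ U') :=
      H.contDiffOn.comp contDiffOn_fst fun y hy ↦ hy.1
    have h2 : ContDiffOn ℝ ∞ (fun y : E × E' ↦ h' y.2) (U ×ˢ U') :=
      H'.contDiffOn.comp contDiffOn_snd fun y hy ↦ hy.2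
    exact ((h1.clm_apply contDiffOn_const).clm_apply contDiffOn_const).add
      ((h2.clm_apply contDiffOn_const).clm_apply contDiffOn_const)
  symm y hy u v := by
    rw [flatProd_apply, flatProd_apply, H.symm _ hy.1, H'.symm _ hy.2]
  pos y hy u hu := by
    rw [flatProd_apply]
    have n1 : 0 ≤ h y.1 u.1 u.1 := by
      by_cases h0 : u.1 = 0
      · simp [h0]
      · exact (H.pos _ hy.1 _ h0).le
    have n2 : 0 ≤ h' y.2 u.2 u.2 := by
      by_cases h0 : u.2 = 0
      · simp [h0]
      · exact (H'.pos _ hy.2 _ h0).le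
    by_cases h0 : u.1 = 0
    · have : u.2 ≠ 0 := fun h1 ↦ hu (Prod.ext h0 h1)
      have := H'.pos _ hy.2 _ this
      linarith
    · have := H.pos _ hy.1 _ h0
      linarith

theorem fderiv_flatProd [FiniteDimensional ℝ E] [FiniteDimensional ℝ E']
    (H : IsFlatMetricOn h U) (H' : IsFlatMetricOn h' U')
    {y : E × E'} (hy : y ∈ U ×ˢ U') (a u v : E × E') :
    fderiv ℝ (flatProd h h') y a u v =
      fderiv ℝ h y.1 a.1 u.1 v.1 + fderiv ℝ h' y.2 a.2 u.2 v.2 := by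
  have hd : HasFDerivAt (flatProd h h') _ y :=
    (((H.prod H').contDiffAt hy).differentiableAt (by simp)).hasFDerivAt
  have h1 : HasFDerivAt h (fderiv ℝ h y.1) y.1 :=
    ((H.contDiffAt hy.1).differentiableAt (by simp)).hasFDerivAt
  have h2 : HasFDerivAt h' (fderiv ℝ h' y.2) y.2 :=
    ((H'.contDiffAt hy.2).differentiableAt (by simp)).hasFDerivAt
  have h3 := (((h1.comp y hasFDerivAt_fst).clm_apply_vec u.1).clm_apply_vec v.1).add
    (((h2.comp y hasFDerivAt_snd).clm_apply_vec u.2).clm_apply_vec v.2)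
  have h4 := (hd.clm_apply_vec u).clm_apply_vec v
  exact congrArg (fun l : E × E' →L[ℝ] ℝ ↦ l a) (h4.unique h3)

theorem flatChristoffel_flatProd [FiniteDimensional ℝ E] [FiniteDimensional ℝ E']
    (H : IsFlatMetricOn h U) (H' : IsFlatMetricOn h' U')
    {y : E × E'} (hy : y ∈ U ×ˢ U') (u v : E × E') :
    flatChristoffel (flatProd h h') y u v =
      (flatChristoffel h y.1 u.1 v.1, flatChristoffel h' y.2 u.2 v.2) := by
  apply flatChristoffel_eq ((H.prod H').pos y hy)
  intro w
  rw [flatProd_apply, flatChristoffelFirst_apply, fderiv_flatProd H H' hy, fderiv_flatProd H H' hy,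
    fderiv_flatProd H H' hy, flatChristoffel_form (H.pos _ hy.1),
    flatChristoffel_form (H'.pos _ hy.2), flatChristoffelFirst_apply, flatChristoffelFirst_apply]
  ring

theorem fderiv_flatChristoffel_flatProd [FiniteDimensional ℝ E] [FiniteDimensional ℝ E']
    (H : IsFlatMetricOn h U) (H' : IsFlatMetricOn h' U')
    {y : E × E'} (hy : y ∈ U ×ˢ U') (a u v : E × E') :
    fderiv ℝ (flatChristoffel (flatProd h h')) y a u v =
      (fderiv ℝ (flatChristoffel h) y.1 a.1 u.1 v.1,
        fderiv ℝ (flatChristoffel h') y.2 a.2 u.2 v.2) := by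
  have ho := (H.prod H').isOpen.mem_nhds hy
  have hd : HasFDerivAt (flatChristoffel (flatProd h h')) _ y :=
    (((H.prod H').contDiffOn_flatChristoffel.contDiffAt ho).differentiableAt (by simp)).hasFDerivAt
  have h1 : HasFDerivAt (flatChristoffel h) (fderiv ℝ (flatChristoffel h) y.1) y.1 :=
    ((H.contDiffOn_flatChristoffel.contDiffAt (H.isOpen.mem_nhds hy.1)).differentiableAt
      (by simp)).hasFDerivAt
  have h2 : HasFDerivAt (flatChristoffel h') (fderiv ℝ (flatChristoffel h') y.2) y.2 :=
    ((H'.contDiffOn_flatChristoffel.contDiffAt (H'.isOpen.mem_nhds hy.2)).differentiableAt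
      (by simp)).hasFDerivAt
  have h3 := (((h1.comp y hasFDerivAt_fst).clm_apply_vec u.1).clm_apply_vec v.1).prodMk
    (((h2.comp y hasFDerivAt_snd).clm_apply_vec u.2).clm_apply_vec v.2)
  have h4 := (hd.clm_apply_vec u).clm_apply_vec v
  have h5 := h4.unique (h3.congr_of_eventuallyEq
    (Filter.eventually_of_mem ho fun z hz ↦ flatChristoffel_flatProd H H' hz u v))
  exact congrArg (fun l : E × E' →L[ℝ] E × E' ↦ l a) h5

theorem flatCurvature_flatProd [FiniteDimensional ℝ E] [FiniteDimensional ℝ E']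
    (H : IsFlatMetricOn h U) (H' : IsFlatMetricOn h' U')
    {y : E × E'} (hy : y ∈ U ×ˢ U') (u v w : E × E') :
    flatCurvature (flatProd h h') y u v w =
      (flatCurvature h y.1 u.1 v.1 w.1, flatCurvature h' y.2 u.2 v.2 w.2) := by
  simp only [flatCurvature, fderiv_flatChristoffel_flatProd H H' hy,
    flatChristoffel_flatProd H H' hy]
  rfl

end FlatProduct

/-! ### Curvature of a Riemannian product. -/

section Product

variable {E : Type*} [NormedAddCommGroup E] [NormedSpace ℝ E] [FiniteDimensional ℝ E]
  {H : Type*} [TopologicalSpace H] {I : ModelWithCorners ℝ E H} [I.Boundaryless]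
  {X : Type*} [TopologicalSpace X] [ChartedSpace H X] [IsManifold I ∞ X]
  {E' : Type*} [NormedAddCommGroup E'] [NormedSpace ℝ E'] [FiniteDimensional ℝ E']
  {H' : Type*} [TopologicalSpace H'] {I' : ModelWithCorners ℝ E' H'} [I'.Boundaryless]
  {X' : Type*} [TopologicalSpace X'] [ChartedSpace H' X'] [IsManifold I' ∞ X']
  {g : MetricField I X} {g' : MetricField I' X'}

omit [FiniteDimensional ℝ E] [FiniteDimensional ℝ E'] in
theorem chartMetric_prod (x : X × X') {y : E × E'}
    (hy : y ∈ (extChartAt I x.1).target ×ˢ (extChartAt I' x.2).target) :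
    chartMetric (g.prod g') x y = flatProd (chartMetric g x.1) (chartMetric g' x.2) y := by
  have h1 : MDifferentiableAt 𝓘(ℝ, E) I (extChartAt I x.1).symm y.1 :=
    ((contMDiffOn_extChartAt_symm (I := I) (n := ∞) x.1).contMDiffAt
      ((isOpen_extChartAt_target x.1).mem_nhds hy.1)).mdifferentiableAt (by simp)
  have h2 : MDifferentiableAt 𝓘(ℝ, E') I' (extChartAt I' x.2).symm y.2 :=
    ((contMDiffOn_extChartAt_symm (I := I') (n := ∞) x.2).contMDiffAt
      ((isOpen_extChartAt_target x.2).mem_nhds hy.2)).mdifferentiableAt (by simp)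
  have h3 := mfderiv_prodMap h1 h2
  have h4 : ⇑(extChartAt (I.prod I') x).symm =
      Prod.map (extChartAt I x.1).symm (extChartAt I' x.2).symm := by
    rw [extChartAt_prod]
    rfl
  -- `mfderiv_prodMap` uses the product of the models of `E` and `E'`; it is identified with the
  -- model of `E × E'` over itself.
  rw [← modelWithCornersSelf_prod, chartedSpaceSelf_prod] at h3
  have h5 : (mfderiv 𝓘(ℝ, E × E') (I.prod I') (extChartAt (I.prod I') x).symm y :
      E × E' →L[ℝ] E × E') = ContinuousLinearMap.prodMap
        (mfderiv 𝓘(ℝ, E) I (extChartAt I x.1).symm y.1 : E →L[ℝ] E)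
        (mfderiv 𝓘(ℝ, E') I' (extChartAt I' x.2).symm y.2 : E' →L[ℝ] E') := by
    rw [h4]
    exact h3
  have h6 : chartMetric (g.prod g') x y =
    ((g.prod g').at ((extChartAt (I.prod I') x).symm y)).bilinearComp
      (mfderiv 𝓘(ℝ, E × E') (I.prod I') (extChartAt (I.prod I') x).symm y :
        E × E' →L[ℝ] E × E')
      (mfderiv 𝓘(ℝ, E × E') (I.prod I') (extChartAt (I.prod I') x).symm y :
        E × E' →L[ℝ] E × E') := rfl
  rw [h6, h5, h4]
  rfl

theorem isFlatMetricOn_chartMetric_prod (x : X × X')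
    (hg : IsFlatMetricOn (chartMetric g x.1) (extChartAt I x.1).target)
    (hg' : IsFlatMetricOn (chartMetric g' x.2) (extChartAt I' x.2).target) :
    IsFlatMetricOn (chartMetric (g.prod g') x)
      ((extChartAt I x.1).target ×ˢ (extChartAt I' x.2).target) := by
  have H := hg.prod hg'
  refine ⟨H.isOpen, H.contDiffOn.congr fun y hy ↦ chartMetric_prod x hy, fun y hy ↦ ?_,
    fun y hy ↦ ?_⟩
  · rw [chartMetric_prod x hy]
    exact H.symm y hy
  · rw [chartMetric_prod x hy]
    exact H.pos y hy

theorem curvature_prod (x : X × X')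
    (hg : IsFlatMetricOn (chartMetric g x.1) (extChartAt I x.1).target)
    (hg' : IsFlatMetricOn (chartMetric g' x.2) (extChartAt I' x.2).target) (u v w : E × E') :
    curvature (g.prod g') x u v w =
      (curvature g x.1 u.1 v.1 w.1, curvature g' x.2 u.2 v.2 w.2) := by
  have hx : (extChartAt I x.1 x.1, extChartAt I' x.2 x.2) ∈
      (extChartAt I x.1).target ×ˢ (extChartAt I' x.2).target :=
    ⟨mem_extChartAt_target x.1, mem_extChartAt_target x.2⟩
  have h1 : curvature (g.prod g') x u v w = flatCurvature (chartMetric (g.prod g') x)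
    (extChartAt I x.1 x.1, extChartAt I' x.2 x.2) u v w := by
    have : extChartAt (I.prod I') x x = (extChartAt I x.1 x.1, extChartAt I' x.2 x.2) := by
      rw [extChartAt_prod]
      rfl
    rw [← this]
    rfl
  have h2 : chartMetric (g.prod g') x =ᶠ[nhds (extChartAt I x.1 x.1, extChartAt I' x.2 x.2)]
      flatProd (chartMetric g x.1) (chartMetric g' x.2) :=
    Filter.eventually_of_mem ((hg.prod hg').isOpen.mem_nhds hx) fun y hy ↦ chartMetric_prod x hy
  rw [h1, flatCurvature_congr h2, flatCurvature_flatProd hg hg' hx]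
  rfl

end Product

/-! ### Curvature of the ambient product, and the bound on its smallest Ricci curvature. -/

section Ambient

variable {p n : ℕ} {X₂ : Type*} [TopologicalSpace X₂] [ChartedSpace (EuclideanSpace ℝ (Fin n)) X₂]
    [IsManifold (𝓡 n) ∞ X₂]
    (g₂ : Bundle.ContMDiffRiemannianMetric (𝓡 n) ∞ (EuclideanSpace ℝ (Fin n))
      (TangentSpace (𝓡 n) : X₂ → Type _))

theorem ambientMetric_at (x : Sph p × X₂)
    (u v : EuclideanSpace ℝ (Fin p) × EuclideanSpace ℝ (Fin n)) :
    (ambientMetric p g₂.inner).at x u v =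
      2 * ((p : ℝ) - 1) * inner ℝ u.1 v.1
        + MetricField.at (I := 𝓡 n) g₂.inner x.2 u.2 v.2 := by
  rw [← sphereMetric_at x.1]
  rfl

theorem curvature_ambientMetric (hp : 2 ≤ p) (x : Sph p × X₂)
    (u v w : EuclideanSpace ℝ (Fin p) × EuclideanSpace ℝ (Fin n)) :
    curvature (ambientMetric p g₂.inner) x u v w =
      (inner ℝ v.1 w.1 • u.1 - inner ℝ u.1 w.1 • v.1,
        curvature (I := 𝓡 n) g₂.inner x.2 u.2 v.2 w.2) := by
  rw [← curvature_sphereMetric hp x.1]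
  exact curvature_prod x (isFlatMetricOn_chartMetric_sphereMetric hp x.1)
    (isFlatMetricOn_chartMetric g₂ x.2) u v w

/-- The smallest Ricci curvature of the product with a sphere is at most that of the sphere. -/
theorem smallestRicci_ambientMetric_le (hp : 2 ≤ p) (x : Sph p × X₂) :
    smallestRicci (ambientMetric p g₂.inner) ≤ 1 / 2 := by
  have hp' : (2 : ℝ) ≤ p := by exact_mod_cast hp
  unfold smallestRicci
  by_cases hb : BddBelow {r : ℝ | ∃ (x : Sph p × X₂)
      (v : EuclideanSpace ℝ (Fin p) × EuclideanSpace ℝ (Fin n)),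
      ambientMetric p g₂.inner x v v = 1 ∧ r = ricci (ambientMetric p g₂.inner) x v v}
  swap
  -- The infimum of a set unbounded below is `0` by convention, so boundedness need not be proved.
  · refine (Real.sInf_of_not_bddBelow hb).trans_le (by norm_num)
  -- A unit vector tangent to the sphere factor. Its Ricci curvature is the trace of `|v₀|² id -
  -- ⟨v₀, ·⟩ v₀`, namely `(p-1)|v₀|² = 1/2`.
  let v₀ : EuclideanSpace ℝ (Fin p) :=
    (√(2 * ((p : ℝ) - 1)))⁻¹ • EuclideanSpace.single (⟨0, by omega⟩ : Fin p) (1 : ℝ)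
  have hc : 0 < 2 * ((p : ℝ) - 1) := by linarith
  have hv₀ : inner ℝ v₀ v₀ = (2 * ((p : ℝ) - 1))⁻¹ := by
    simp only [v₀, inner_smul_left, inner_smul_right, conj_trivial]
    rw [real_inner_self_eq_norm_sq]
    simp only [PiLp.norm_single, norm_one, one_pow, mul_one]
    rw [← mul_inv, Real.mul_self_sqrt hc.le]
  refine csInf_le hb ⟨x, (v₀, 0), ?_, ?_⟩
  · change (ambientMetric p g₂.inner).at x (v₀, 0) (v₀, 0) = 1
    rw [ambientMetric_at, hv₀]
    simp only [map_zero, add_zero]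
    exact mul_inv_cancel₀ hc.ne'
  · let L : EuclideanSpace ℝ (Fin p) →ₗ[ℝ] EuclideanSpace ℝ (Fin p) :=
      (inner ℝ v₀ v₀ : ℝ) • LinearMap.id - ((innerₛₗ ℝ v₀).smulRight v₀)
    have hL : ricci (ambientMetric p g₂.inner) x (v₀, 0) (v₀, 0) = LinearMap.trace ℝ
        (EuclideanSpace ℝ (Fin p) × EuclideanSpace ℝ (Fin n)) (L.prodMap 0) := by
      unfold ricci
      congr 1
      refine LinearMap.ext fun z ↦ ?_
      change curvature (ambientMetric p g₂.inner) x z (v₀, 0) (v₀, 0) = (L z.1, 0)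
      rw [curvature_ambientMetric g₂ hp]
      have ht := isTrilinear_flatCurvature (chartMetric (I := 𝓡 n) g₂.inner x.2)
        (extChartAt (𝓡 n) x.2 x.2)
      have h0 : curvature (I := 𝓡 n) g₂.inner x.2 z.2 0 0 = 0 := (ht.snd z.2 0).map_zero
      simp only [h0]
      simp [L, real_inner_comm]
    rw [hL, LinearMap.trace_prodMap', map_zero, add_zero]
    simp only [L, map_sub, map_smul, LinearMap.trace_id, LinearMap.trace_smulRight]
    have hp1 : (p : ℝ) - 1 ≠ 0 := by linarith
    rw [innerₛₗ_apply_apply, hv₀, finrank_euclideanSpace_fin, smul_eq_mul]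
    field_simp

end Ambient

/-! ### Simons' term in components: the constant curvature model and its perturbation. -/

section Algebra

variable {p n : ℕ}

theorem abs_sum_le_card_mul {ι : Type*} [Fintype ι] {f : ι → ℝ} {c : ℝ} (h : ∀ i, |f i| ≤ c) :
    |∑ i, f i| ≤ Fintype.card ι * c := by
  refine (Finset.abs_sum_le_sum_abs _ _).trans ?_
  refine (Finset.sum_le_sum fun i _ ↦ h i).trans ?_
  simp

/-- The components of the curvature term of Simons' equation, in terms of the components `a` of the
second fundamental form and of components `X`, `Q`, `Z` of the curvature tensor. -/
def simonsComponent (a : Fin n → Fin p → Fin p → ℝ) (X : Fin p → Fin p → Fin n → Fin n → ℝ)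
    (Q : Fin p → Fin p → Fin p → Fin p → ℝ) (Z : Fin p → Fin n → Fin n → ℝ)
    (j : Fin n) (k l : Fin p) : ℝ :=
  ∑ i, (2 * ∑ r, a r k i * X i l r j + 2 * ∑ r, a r l i * X i k r j
    - ∑ s, a j k s * Q i l i s - ∑ s, a j l s * Q i k i s + ∑ r, a r k l * Z i r j
    - 2 * ∑ s, a j i s * Q i k l s)

/-- The components of a curvature tensor of constant curvature `κ`. -/
def constantCurvature (κ : ℝ) (i l k s : Fin p) : ℝ :=
  κ * ((if l = k then 1 else 0) * (if i = s then 1 else 0)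
    - (if i = k then 1 else 0) * (if l = s then 1 else 0))

/-- The model case of a tangent space equal to the sphere factor. Each of the two contractions of `Q
i l i s` contributes `κ(p-1) a`, and the last term contributes `2κ a`. -/
theorem simonsComponent_constantCurvature {a : Fin n → Fin p → Fin p → ℝ}
    (symm : ∀ j k l, a j k l = a j l k) (trace : ∀ j, ∑ i, a j i i = 0) (κ : ℝ)
    (j : Fin n) (k l : Fin p) :
    simonsComponent a (fun _ _ _ _ ↦ 0) (constantCurvature κ) (fun _ _ _ ↦ 0) j k l =
      κ * (2 * (p - 1) + 2) * a j k l := by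
  have h1 : ∀ k l : Fin p, ∑ i : Fin p, ∑ s : Fin p, a j k s * constantCurvature κ i l i s =
      -(κ * (p - 1) * a j k l) := fun k l ↦ by
    have : ∀ i s : Fin p, a j k s * constantCurvature κ i l i s =
      κ * ((if l = i then (if i = s then a j k s else 0) else 0)
        - (if l = s then a j k s else 0)) := fun i s ↦ by
      unfold constantCurvature
      split_ifs <;> (simp_all; try ring)
    simp_rw [this, ← Finset.mul_sum, Finset.sum_sub_distrib]
    simp
    ring
  have h2 : ∑ i : Fin p, ∑ s : Fin p, a j i s * constantCurvature κ i k l s =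
      -(κ * a j k l) := by
    have : ∀ i s : Fin p, a j i s * constantCurvature κ i k l s =
      κ * ((if k = l then (if i = s then a j i s else 0) else 0)
        - (if k = s then (if i = l then a j i s else 0) else 0)) := fun i s ↦ by
      unfold constantCurvature
      split_ifs <;> simp_all [mul_comm]
    simp_rw [this, ← Finset.mul_sum, Finset.sum_sub_distrib]
    rw [symm j k l]
    -- Minimality enters here: the term with the Kronecker symbol of `k, l` is a trace of `a`.
    have h3 : ∑ i : Fin p, ∑ s : Fin p, (if k = l then (if i = s then a j i s else 0) else 0)
        = 0 := by
      split_ifs with hkl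
      · simpa using trace j
      · simp
    rw [h3]
    simp
  unfold simonsComponent
  simp only [mul_zero, Finset.sum_const_zero, zero_sub, add_zero, Finset.sum_sub_distrib,
    Finset.sum_neg_distrib, ← Finset.mul_sum]
  rw [h1, h1, h2, symm j l k]
  ring

theorem simonsComponent_sub {a : Fin n → Fin p → Fin p → ℝ}
    (X X' : Fin p → Fin p → Fin n → Fin n → ℝ) (Q Q' : Fin p → Fin p → Fin p → Fin p → ℝ)
    (Z Z' : Fin p → Fin n → Fin n → ℝ) (j : Fin n) (k l : Fin p) :
    simonsComponent a X Q Z j k l - simonsComponent a X' Q' Z' j k l =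
      simonsComponent a (X - X') (Q - Q') (Z - Z') j k l := by
  unfold simonsComponent
  rw [← Finset.sum_sub_distrib]
  refine Finset.sum_congr rfl fun i _ ↦ ?_
  simp only [Pi.sub_apply, mul_sub, Finset.sum_sub_distrib]
  ring

/-- For each `i`, the sums over normal indices have total weight `2 + 2 + 1` and those over tangent
indices `1 + 1 + 2`, whence `5n + 4p`. -/
theorem abs_simonsComponent_le {a : Fin n → Fin p → Fin p → ℝ}
    {X : Fin p → Fin p → Fin n → Fin n → ℝ} {Q : Fin p → Fin p → Fin p → Fin p → ℝ}
    {Z : Fin p → Fin n → Fin n → ℝ} {s c : ℝ} (hs : 0 ≤ s) (ha : ∀ j k l, |a j k l| ≤ s)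
    (hX : ∀ i l r j, |X i l r j| ≤ c) (hQ : ∀ i l k s, |Q i l k s| ≤ c)
    (hZ : ∀ i r j, |Z i r j| ≤ c) (j : Fin n) (k l : Fin p) :
    |simonsComponent a X Q Z j k l| ≤ p * ((5 * n + 4 * p) * (s * c)) := by
  have hmul : ∀ {x y : ℝ}, |x| ≤ s → |y| ≤ c → |x * y| ≤ s * c := fun hx hy ↦ by
    rw [abs_mul]
    exact mul_le_mul hx hy (abs_nonneg _) hs
  unfold simonsComponent
  refine (abs_sum_le_card_mul (c := (5 * n + 4 * p) * (s * c)) fun i ↦ ?_).trans (by simp)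
  have h1 := abs_sum_le_card_mul fun r ↦ hmul (ha r k i) (hX i l r j)
  have h2 := abs_sum_le_card_mul fun r ↦ hmul (ha r l i) (hX i k r j)
  have h3 := abs_sum_le_card_mul fun s ↦ hmul (ha j k s) (hQ i l i s)
  have h4 := abs_sum_le_card_mul fun s ↦ hmul (ha j l s) (hQ i k i s)
  have h5 := abs_sum_le_card_mul fun r ↦ hmul (ha r k l) (hZ i r j)
  have h6 := abs_sum_le_card_mul fun s ↦ hmul (ha j i s) (hQ i k l s)
  simp only [Fintype.card_fin, abs_le] at *
  constructor <;> linarith [h1.1, h1.2, h2.1, h2.2, h3.1, h3.2, h4.1, h4.2, h5.1, h5.2, h6.1, h6.2]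

/-- By linearity in the curvature, the deviation from the model is Simons' term of the deviation.
Every component of `a` is at most `√N`, where `N` is the squared norm, so each of the `n p²`
products is off by at most `p(5n + 4p) c N`. -/
theorem sum_simonsComponent_ge {a : Fin n → Fin p → Fin p → ℝ}
    (symm : ∀ j k l, a j k l = a j l k) (trace : ∀ j, ∑ i, a j i i = 0) {κ c : ℝ}
    {X : Fin p → Fin p → Fin n → Fin n → ℝ} {Q : Fin p → Fin p → Fin p → Fin p → ℝ}
    {Z : Fin p → Fin n → Fin n → ℝ} (hX : ∀ i l r j, |X i l r j| ≤ c)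
    (hQ : ∀ i l k s, |Q i l k s - constantCurvature κ i l k s| ≤ c)
    (hZ : ∀ i r j, |Z i r j| ≤ c) :
    (κ * (2 * (p - 1) + 2) - n * p ^ 3 * (5 * n + 4 * p) * c) * ∑ j, ∑ k, ∑ l, a j k l ^ 2 ≤
      ∑ j, ∑ k, ∑ l, simonsComponent a X Q Z j k l * a j k l := by
  set N := ∑ j, ∑ k, ∑ l, a j k l ^ 2 with hN
  have hN0 : 0 ≤ N := Finset.sum_nonneg fun j _ ↦ Finset.sum_nonneg fun k _ ↦
    Finset.sum_nonneg fun l _ ↦ sq_nonneg _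
  have ha : ∀ j k l, |a j k l| ≤ √N := fun j k l ↦ by
    apply Real.abs_le_sqrt
    have h3 := Finset.single_le_sum (f := fun l ↦ a j k l ^ 2) (fun l _ ↦ sq_nonneg _)
      (Finset.mem_univ l)
    have h2 := Finset.single_le_sum (f := fun k ↦ ∑ l, a j k l ^ 2)
      (fun k _ ↦ Finset.sum_nonneg fun l _ ↦ sq_nonneg _) (Finset.mem_univ k)
    have h1 := Finset.single_le_sum (f := fun j ↦ ∑ k, ∑ l, a j k l ^ 2)
      (fun j _ ↦ Finset.sum_nonneg fun k _ ↦ Finset.sum_nonneg fun l _ ↦ sq_nonneg _)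
      (Finset.mem_univ j)
    exact h3.trans (h2.trans h1)
  have hE : ∀ j k l, |(simonsComponent a X Q Z j k l - κ * (2 * (p - 1) + 2) * a j k l) * a j k l|
      ≤ p * ((5 * n + 4 * p) * c) * N := fun j k l ↦ by
    rw [← simonsComponent_constantCurvature symm trace, simonsComponent_sub, abs_mul]
    have h1 := abs_simonsComponent_le (a := a) (X := X - fun _ _ _ _ ↦ 0)
      (Q := Q - constantCurvature κ) (Z := Z - fun _ _ _ ↦ 0) (Real.sqrt_nonneg N) ha
      (by simpa using hX) hQ (by simpa using hZ) j k l
    have h2 := mul_le_mul h1 (ha j k l) (abs_nonneg _) ((abs_nonneg _).trans h1)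
    refine h2.trans_eq ?_
    linear_combination (p * ((5 * n + 4 * p) * c)) * Real.mul_self_sqrt hN0
  have hsum := abs_sum_le_card_mul fun j ↦ abs_sum_le_card_mul fun k ↦
    abs_sum_le_card_mul fun l ↦ hE j k l
  have hsplit : ∑ j, ∑ k, ∑ l,
      (simonsComponent a X Q Z j k l - κ * (2 * (p - 1) + 2) * a j k l) * a j k l =
      ∑ j, ∑ k, ∑ l, simonsComponent a X Q Z j k l * a j k l - κ * (2 * (p - 1) + 2) * N := by
    rw [hN]
    simp only [Finset.mul_sum, ← Finset.sum_sub_distrib]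
    refine Finset.sum_congr rfl fun j _ ↦ Finset.sum_congr rfl fun k _ ↦
      Finset.sum_congr rfl fun l _ ↦ ?_
    ring
  rw [hsplit] at hsum
  simp only [Fintype.card_fin] at hsum
  have := (abs_le.1 hsum).1
  linarith

end Algebra

/-! ### The second fundamental form of an immersion. -/

section Submanifold

variable {E : Type*} [NormedAddCommGroup E] [NormedSpace ℝ E] [FiniteDimensional ℝ E]
  {H : Type*} [TopologicalSpace H] {I : ModelWithCorners ℝ E H}
  {X : Type*} [TopologicalSpace X] [ChartedSpace H X]
  {F : Type*} [NormedAddCommGroup F] [NormedSpace ℝ F] [FiniteDimensional ℝ F]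
  {G : Type*} [TopologicalSpace G] {J : ModelWithCorners ℝ F G}
  {M : Type*} [TopologicalSpace M] [ChartedSpace G M]
  {g : MetricField I X} {f : M → X} {m : M}

omit [FiniteDimensional ℝ E] [FiniteDimensional ℝ F] in
theorem inducedMetric_apply (u v : F) : inducedMetric J g f m u v =
    g.at (f m) (tangentMap' I J f m u) (tangentMap' I J f m v) := rfl

omit [FiniteDimensional ℝ E] [FiniteDimensional ℝ F] in
theorem inducedMetric_pos (pos : ∀ u, u ≠ 0 → 0 < g.at (f m) u u)
    (hf : Function.Injective (tangentMap' I J f m)) (u : F) (hu : u ≠ 0) :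
    0 < inducedMetric J g f m u u :=
  pos _ fun h ↦ hu (hf (h.trans (map_zero _).symm))

omit [FiniteDimensional ℝ E] in
theorem inducedMetric_shapeOperator (pos : ∀ u, u ≠ 0 → 0 < g.at (f m) u u)
    (hf : Function.Injective (tangentMap' I J f m)) (η : E) (u v : F) :
    inducedMetric J g f m (shapeOperator J g f m η u) v =
      g.at (f m) (secondFundamentalForm J g f m u v) η := by
  have h : shapeOperator J g f m η u = (inducedMetric J g f m).inverse
    ((g.at (f m)).flip η ∘L secondFundamentalForm J g f m u) := rfl
  rw [h, (isInvertible_of_pos (inducedMetric_pos pos hf)).self_apply_inverse]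
  rfl

omit [FiniteDimensional ℝ E] in
theorem secondFundamentalForm_normal (pos : ∀ u, u ≠ 0 → 0 < g.at (f m) u u)
    (hf : Function.Injective (tangentMap' I J f m)) (u v w : F) :
    g.at (f m) (secondFundamentalForm J g f m u v) (tangentMap' I J f m w) = 0 := by
  set z := covariantHessian J g f m u v with hz
  have h : secondFundamentalForm J g f m u v = z - tangentMap' I J f m
    ((inducedMetric J g f m).inverse (g.at (f m) z ∘L tangentMap' I J f m)) := rfl
  rw [h, map_sub, sub_apply, ← inducedMetric_apply,
    (isInvertible_of_pos (inducedMetric_pos pos hf)).self_apply_inverse]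
  simp

omit [FiniteDimensional ℝ F] in
-- Both parts of the covariant Hessian are symmetric: the second derivative in charts, and the
-- Christoffel term, as the connection is torsion-free.
theorem secondFundamentalForm_symm [I.Boundaryless] [J.Boundaryless] [IsManifold I ∞ X]
    [IsManifold J ∞ M] {U : Set E}
    (hg : IsFlatMetricOn (chartMetric g (f m)) U) (hU : extChartAt I (f m) (f m) ∈ U)
    (hf : ContMDiff J I ∞ f) (u v : F) :
    secondFundamentalForm J g f m u v = secondFundamentalForm J g f m v u := by
  have h : ∀ u v, secondFundamentalForm J g f m u v = normalProj J g f m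
    (fderiv ℝ (fderiv ℝ (writtenInExtChartAt J I m f)) (extChartAt J m m) u v
      + flatChristoffel (chartMetric g (f m)) (extChartAt I (f m) (f m))
        (tangentMap' I J f m u) (tangentMap' I J f m v)) := fun u v ↦ rfl
  have h1 : ContDiffAt ℝ ∞ (writtenInExtChartAt J I m f) (extChartAt J m m) := by
    have := (contMDiffAt_iff.1 (hf m)).2
    rwa [J.range_eq_univ, contDiffWithinAt_univ] at this
  rw [h, h, hg.flatChristoffel_symm hU,
    h1.isSymmSndFDerivAt (by simpa using ENat.LEInfty.out) u v]

end Submanifold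

/-! ### Components in an adapted frame. -/

section Components

variable {E : Type*} [NormedAddCommGroup E] [NormedSpace ℝ E]
  {H : Type*} [TopologicalSpace H] {I : ModelWithCorners ℝ E H}
  {X : Type*} [TopologicalSpace X] [ChartedSpace H X]
  {F : Type*} [NormedAddCommGroup F] [NormedSpace ℝ F] [FiniteDimensional ℝ F]
  {G : Type*} [TopologicalSpace G] {J : ModelWithCorners ℝ F G}
  {M : Type*} [TopologicalSpace M] [ChartedSpace G M]
  {g : MetricField I X} {f : M → X} {m : M} {p n : ℕ} {e : Fin p → F} {η : Fin n → E}

omit [FiniteDimensional ℝ F] in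
theorem isDualPair_tangent (hF : finrank ℝ F = p) (he : IsAdaptedFrame J g f m e η) :
    IsDualPair (inducedMetric J g f m) e e := by
  refine ⟨by simp [hF], fun i j ↦ ?_⟩
  split_ifs with h
  · rw [← h, he.tangent_self]
  · exact he.tangent_ne i j h

variable (I J) in
/-- The union of the tangent and of the normal frame. -/
def adaptedFrame (f : M → X) (m : M) (e : Fin p → F) (η : Fin n → E) :
    Fin p ⊕ Fin n → E :=
  Sum.elim (fun i ↦ tangentMap' I J f m (e i)) η

omit [FiniteDimensional ℝ F] in
theorem isDualPair_adaptedFrame (hE : finrank ℝ E = p + n)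
    (symm : ∀ u v, g.at (f m) u v = g.at (f m) v u) (he : IsAdaptedFrame J g f m e η) :
    IsDualPair (g.at (f m)) (adaptedFrame I J f m e η) (adaptedFrame I J f m e η) := by
  refine ⟨by simp [hE], fun i j ↦ ?_⟩
  have hN : ∀ i j, g.at (f m) (η j) (tangentMap' I J f m (e i)) = 0 :=
    fun i j ↦ he.isNormalAt j (e i)
  rcases i with i | i <;> rcases j with j | j <;> simp only [adaptedFrame, Sum.elim_inl, Sum.elim_inr]
  · split_ifs with h
    · rw [← Sum.inl_injective h]
      exact he.tangent_self i
    · exact he.tangent_ne i j fun h' ↦ h (congrArg _ h')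
  · rw [symm, hN]
    simp
  · rw [hN]
    simp
  · split_ifs with h
    · rw [← Sum.inr_injective h]
      exact he.normal_self i
    · exact he.normal_ne i j fun h' ↦ h (congrArg _ h')

variable (J) in
/-- The components of the second fundamental form in a frame. -/
def secondFundamentalComponent (g : MetricField I X) (f : M → X)
    (m : M) (e : Fin p → F) (η : Fin n → E) (j : Fin n) (k l : Fin p) : ℝ :=
  g.at (f m) (secondFundamentalForm J g f m (e k) (e l)) (η j)

/-- The curvature tensor with lowered index. -/
def loweredCurvature (g : MetricField I X) (x : X) (u v w z : E) : ℝ :=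
  g.at x (curvature g x u v w) z

theorem secondFundamentalForm_expand [FiniteDimensional ℝ E] (hE : finrank ℝ E = p + n)
    (symm : ∀ u v, g.at (f m) u v = g.at (f m) v u) (pos : ∀ u, u ≠ 0 → 0 < g.at (f m) u u)
    (hf : Function.Injective (tangentMap' I J f m)) (he : IsAdaptedFrame J g f m e η)
    (k l : Fin p) : secondFundamentalForm J g f m (e k) (e l) =
      ∑ r, secondFundamentalComponent J g f m e η r k l • η r := by
  have := (isDualPair_adaptedFrame hE symm he).sum_left
    (secondFundamentalForm J g f m (e k) (e l))
  rw [Fintype.sum_sum_type] at this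
  simp only [adaptedFrame, Sum.elim_inl, Sum.elim_inr, secondFundamentalForm_normal pos hf,
    zero_smul, Finset.sum_const_zero, zero_add] at this
  exact this.symm

theorem shapeOperator_expand (hF : finrank ℝ F = p) (pos : ∀ u, u ≠ 0 → 0 < g.at (f m) u u)
    (hf : Function.Injective (tangentMap' I J f m)) (he : IsAdaptedFrame J g f m e η)
    (j : Fin n) (k : Fin p) : shapeOperator J g f m (η j) (e k) =
      ∑ s, secondFundamentalComponent J g f m e η j k s • e s := by
  have := (isDualPair_tangent hF he).sum_left (shapeOperator J g f m (η j) (e k))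
  simp_rw [inducedMetric_shapeOperator pos hf] at this
  exact this.symm

theorem isTrilinear_curvature (g : MetricField I X) (x : X) : IsTrilinear (curvature g x) :=
  isTrilinear_flatCurvature (chartMetric g x) (extChartAt I x x)

theorem loweredCurvature_sum_trd {ι : Type*} [Fintype ι] (x : X) (u v z : E) (c : ι → ℝ)
    (w : ι → E) : loweredCurvature g x u v (∑ r, c r • w r) z =
      ∑ r, c r * loweredCurvature g x u v (w r) z := by
  have := map_sum (((isTrilinear_curvature g x).comp_trd ((g.at x).flip z) u v).mk')
    (fun r ↦ c r • w r) Finset.univ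
  exact this.trans (Finset.sum_congr rfl fun r _ ↦
    ((isTrilinear_curvature g x).comp_trd ((g.at x).flip z) u v).map_smul _ _)

theorem loweredCurvature_sum_snd {ι : Type*} [Fintype ι] (x : X) (u w z : E) (c : ι → ℝ)
    (v : ι → E) : loweredCurvature g x u (∑ r, c r • v r) w z =
      ∑ r, c r * loweredCurvature g x u (v r) w z := by
  have := map_sum (((isTrilinear_curvature g x).comp_snd ((g.at x).flip z) u w).mk')
    (fun r ↦ c r • v r) Finset.univ
  exact this.trans (Finset.sum_congr rfl fun r _ ↦
    ((isTrilinear_curvature g x).comp_snd ((g.at x).flip z) u w).map_smul _ _)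

/-- Reduces the geometry to algebra: `B` has only normal components and `A^η` only tangent ones, and
all terms are linear in them. -/
theorem simonsTerm_eq [FiniteDimensional ℝ E] (hE : finrank ℝ E = p + n) (hF : finrank ℝ F = p)
    (symm : ∀ u v, g.at (f m) u v = g.at (f m) v u) (pos : ∀ u, u ≠ 0 → 0 < g.at (f m) u u)
    (hf : Function.Injective (tangentMap' I J f m)) (he : IsAdaptedFrame J g f m e η)
    (j : Fin n) (k l : Fin p) :
    simonsTerm J g f m e (η j) (e k) (e l) =
      simonsComponent (secondFundamentalComponent J g f m e η)
        (fun i l r j ↦ loweredCurvature g (f m) (tangentMap' I J f m (e i))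
          (tangentMap' I J f m (e l)) (η r) (η j))
        (fun i l k s ↦ loweredCurvature g (f m) (tangentMap' I J f m (e i))
          (tangentMap' I J f m (e l)) (tangentMap' I J f m (e k)) (tangentMap' I J f m (e s)))
        (fun i r j ↦ loweredCurvature g (f m) (tangentMap' I J f m (e i)) (η r)
          (tangentMap' I J f m (e i)) (η j)) j k l := by
  have hB := secondFundamentalForm_expand hE symm pos hf he
  have hA : ∀ j k (V : E), g.at (f m) (tangentMap' I J f m (shapeOperator J g f m (η j) (e k))) V =
      ∑ s, secondFundamentalComponent J g f m e η j k s *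
        g.at (f m) V (tangentMap' I J f m (e s)) := fun j k V ↦ by
    rw [shapeOperator_expand hF pos hf he, symm]
    simp
  unfold simonsTerm simonsComponent
  refine Finset.sum_congr rfl fun i _ ↦ ?_
  have h1 : ∀ k l, g.at (f m) (curvature g (f m) (tangentMap' I J f m (e i))
      (tangentMap' I J f m (e l)) (secondFundamentalForm J g f m (e k) (e i))) (η j) =
      ∑ r, secondFundamentalComponent J g f m e η r k i * loweredCurvature g (f m)
        (tangentMap' I J f m (e i)) (tangentMap' I J f m (e l)) (η r) (η j) := fun k l ↦ by
    rw [hB, ← loweredCurvature_sum_trd]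
    rfl
  have h2 : g.at (f m) (curvature g (f m) (tangentMap' I J f m (e i))
      (secondFundamentalForm J g f m (e k) (e l)) (tangentMap' I J f m (e i))) (η j) =
      ∑ r, secondFundamentalComponent J g f m e η r k l * loweredCurvature g (f m)
        (tangentMap' I J f m (e i)) (η r) (tangentMap' I J f m (e i)) (η j) := by
    rw [hB, ← loweredCurvature_sum_snd]
    rfl
  simp only [h1, h2, hA]
  rfl

theorem simonsInner_eq (pos : ∀ u, u ≠ 0 → 0 < g.at (f m) u u)
    (hf : Function.Injective (tangentMap' I J f m)) :
    simonsInner J g f m e η = ∑ j, ∑ k, ∑ l, simonsTerm J g f m e (η j) (e k) (e l) *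
      secondFundamentalComponent J g f m e η j k l := by
  simp only [simonsInner, inducedMetric_shapeOperator pos hf, secondFundamentalComponent]

theorem normSqA_eq (hF : finrank ℝ F = p) (pos : ∀ u, u ≠ 0 → 0 < g.at (f m) u u)
    (hf : Function.Injective (tangentMap' I J f m)) (he : IsAdaptedFrame J g f m e η) :
    normSqA J g f m e η =
      ∑ j, ∑ k, ∑ l, secondFundamentalComponent J g f m e η j k l ^ 2 := by
  unfold normSqA
  refine Finset.sum_congr rfl fun j _ ↦ Finset.sum_congr rfl fun k _ ↦ ?_
  have h := shapeOperator_expand hF pos hf he j k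
  have h2 : ∀ s, inducedMetric J g f m (shapeOperator J g f m (η j) (e k)) (e s) =
      secondFundamentalComponent J g f m e η j k s := fun s ↦
    inducedMetric_shapeOperator pos hf (η j) (e k) (e s)
  nth_rewrite 2 [h]
  rw [map_sum]
  simp only [map_smul, smul_eq_mul, h2, sq]

theorem sum_secondFundamentalComponent_eq_zero (hF : finrank ℝ F = p)
    (pos : ∀ u, u ≠ 0 → 0 < g.at (f m) u u) (hf : Function.Injective (tangentMap' I J f m))
    (he : IsAdaptedFrame J g f m e η) (hmin : IsMinimal J g f) (j : Fin n) :
    ∑ i, secondFundamentalComponent J g f m e η j i i = 0 := by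
  rw [← hmin m (η j) (he.isNormalAt j), (isDualPair_tangent hF he).trace_eq]
  exact Finset.sum_congr rfl fun i _ ↦
    (inducedMetric_shapeOperator pos hf (η j) (e i) (e i)).symm

end Components

/-! ### The sphere part of the ambient metric. -/

section AmbientEstimates

variable {p n : ℕ} {X₂ : Type*} [TopologicalSpace X₂] [ChartedSpace (EuclideanSpace ℝ (Fin n)) X₂]
    [IsManifold (𝓡 n) ∞ X₂]
    (g₂ : Bundle.ContMDiffRiemannianMetric (𝓡 n) ∞ (EuclideanSpace ℝ (Fin n))
      (TangentSpace (𝓡 n) : X₂ → Type _))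

theorem ambientMetric_symm (x : Sph p × X₂)
    (u v : EuclideanSpace ℝ (Fin p) × EuclideanSpace ℝ (Fin n)) :
    (ambientMetric p g₂.inner).at x u v = (ambientMetric p g₂.inner).at x v u := by
  rw [ambientMetric_at, ambientMetric_at, real_inner_comm v.1 u.1]
  congr 1
  exact g₂.symm _ _ _

theorem ambientMetric_pos (hp : 2 ≤ p) (x : Sph p × X₂)
    (u : EuclideanSpace ℝ (Fin p) × EuclideanSpace ℝ (Fin n)) (hu : u ≠ 0) :
    0 < (ambientMetric p g₂.inner).at x u u := by
  have H := isFlatMetricOn_chartMetric_prod x (isFlatMetricOn_chartMetric_sphereMetric hp x.1)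
    (isFlatMetricOn_chartMetric g₂ x.2)
  have h1 := H.pos (extChartAt (𝓡 p) x.1 x.1, extChartAt (𝓡 n) x.2 x.2)
    ⟨mem_extChartAt_target x.1, mem_extChartAt_target x.2⟩ u hu
  rw [chartMetric_prod x ⟨mem_extChartAt_target x.1, mem_extChartAt_target x.2⟩, flatProd_apply,
    chartMetric_self, chartMetric_self] at h1
  exact h1

/-- The part of the ambient metric coming from the sphere. -/
def sphereForm (p n : ℕ) (u v : EuclideanSpace ℝ (Fin p) × EuclideanSpace ℝ (Fin n)) : ℝ :=
  2 * ((p : ℝ) - 1) * inner ℝ u.1 v.1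

theorem abs_sphereForm_le (hp : 2 ≤ p)
    (u v : EuclideanSpace ℝ (Fin p) × EuclideanSpace ℝ (Fin n)) :
    |sphereForm p n u v| ≤ √(sphereForm p n u u) * √(sphereForm p n v v) := by
  have hp' : (2 : ℝ) ≤ p := by exact_mod_cast hp
  have hc : 0 ≤ 2 * ((p : ℝ) - 1) := by linarith
  unfold sphereForm
  rw [abs_mul, abs_of_nonneg hc, Real.sqrt_mul hc, Real.sqrt_mul hc,
    mul_mul_mul_comm, Real.mul_self_sqrt hc, real_inner_self_eq_norm_sq, real_inner_self_eq_norm_sq,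
    Real.sqrt_sq (norm_nonneg _), Real.sqrt_sq (norm_nonneg _)]
  exact mul_le_mul_of_nonneg_left (abs_real_inner_le_norm _ _) hc

theorem sphereForm_comm (u v : EuclideanSpace ℝ (Fin p) × EuclideanSpace ℝ (Fin n)) :
    sphereForm p n u v = sphereForm p n v u := by
  unfold sphereForm
  rw [real_inner_comm]

theorem sphereForm_self_nonneg (hp : 2 ≤ p)
    (u : EuclideanSpace ℝ (Fin p) × EuclideanSpace ℝ (Fin n)) : 0 ≤ sphereForm p n u u := by
  have hp' : (2 : ℝ) ≤ p := by exact_mod_cast hp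
  exact mul_nonneg (by linarith) real_inner_self_nonneg

theorem ambientMetric_eq (x : Sph p × X₂)
    (u v : EuclideanSpace ℝ (Fin p) × EuclideanSpace ℝ (Fin n)) :
    (ambientMetric p g₂.inner).at x u v = sphereForm p n u v
      + MetricField.at (I := 𝓡 n) g₂.inner x.2 u.2 v.2 := ambientMetric_at g₂ x u v

/-- In the sphere term one Euclidean inner product comes from the curvature tensor and one from the
metric. Writing both through `sphereForm` leaves one factor `1/(2(p-1))`, the sectional curvature.
-/
theorem loweredCurvature_ambientMetric (hp : 2 ≤ p) (x : Sph p × X₂)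
    (u v w z : EuclideanSpace ℝ (Fin p) × EuclideanSpace ℝ (Fin n)) :
    loweredCurvature (ambientMetric p g₂.inner) x u v w z =
      (2 * ((p : ℝ) - 1))⁻¹ * (sphereForm p n v w * sphereForm p n u z
        - sphereForm p n u w * sphereForm p n v z)
      + MetricField.at (I := 𝓡 n) g₂.inner x.2
        (curvature (I := 𝓡 n) g₂.inner x.2 u.2 v.2 w.2) z.2 := by
  have hp' : (2 : ℝ) ≤ p := by exact_mod_cast hp
  have hc : (p : ℝ) - 1 ≠ 0 := by linarith
  rw [loweredCurvature, curvature_ambientMetric g₂ hp, ambientMetric_at]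
  congr 1
  simp only [sphereForm, inner_sub_left, inner_smul_left, conj_trivial]
  field_simp

/-- The trace of the sphere part of the metric is the dimension of the sphere. -/
theorem sum_sphereForm (hp : 2 ≤ p) (x : Sph p × X₂) {ι : Type*} [Fintype ι] [DecidableEq ι]
    {c : ι → EuclideanSpace ℝ (Fin p) × EuclideanSpace ℝ (Fin n)}
    (h : IsDualPair ((ambientMetric p g₂.inner).at x) c c) :
    ∑ i, sphereForm p n (c i) (c i) = p := by
  have hp' : (2 : ℝ) ≤ p := by exact_mod_cast hp
  have hc : 2 * ((p : ℝ) - 1) ≠ 0 := by linarith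
  have hH := isFlatMetricOn_chartMetric g₂ x.2
  have hx := mem_extChartAt_target (I := 𝓡 n) x.2
  obtain ⟨o, ho⟩ := exists_orthonormal_dualPair (hH.symm _ hx) (hH.pos _ hx)
  rw [chartMetric_self] at ho
  let s : Fin p → EuclideanSpace ℝ (Fin p) := EuclideanSpace.basisFun (Fin p) ℝ
  have hs : ∀ i j, inner ℝ (s i) (s j) = if i = j then (1 : ℝ) else 0 := 
    (EuclideanSpace.basisFun (Fin p) ℝ).inner_eq_ite
  -- The trace is computed in a dual pair adapted to the splitting. The standard basis of the sphere
  -- factor is not of unit length, so its dual carries the factor `1/(2(p-1))`.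
  let c' : Fin p ⊕ Fin (finrank ℝ (EuclideanSpace ℝ (Fin n))) →
    EuclideanSpace ℝ (Fin p) × EuclideanSpace ℝ (Fin n) := Sum.elim (fun i ↦ (s i, 0)) fun j ↦ (0, o j)
  let d' : Fin p ⊕ Fin (finrank ℝ (EuclideanSpace ℝ (Fin n))) →
    EuclideanSpace ℝ (Fin p) × EuclideanSpace ℝ (Fin n) :=
    Sum.elim (fun i ↦ ((2 * ((p : ℝ) - 1))⁻¹ • s i, 0)) fun j ↦ (0, o j)
  have h' : IsDualPair ((ambientMetric p g₂.inner).at x) c' d' := by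
    refine ⟨by simp, fun i j ↦ ?_⟩
    rw [ambientMetric_at]
    rcases i with i | i <;> rcases j with j | j <;> simp only [c', d', Sum.elim_inl, Sum.elim_inr]
    · simp only [inner_smul_right, hs, map_zero, add_zero, Sum.inl.injEq]
      rw [← mul_assoc, mul_inv_cancel₀ hc, one_mul]
    · simp
    · simp
    · simp [ho.apply]
  have hl : ∀ v, IsLinearMap ℝ (sphereForm p n · v) := fun v ↦
    ⟨fun a b ↦ by simp [sphereForm, inner_add_left, mul_add], fun a b ↦ by
      simp only [sphereForm, Prod.smul_fst, inner_smul_left, conj_trivial, smul_eq_mul]; ring⟩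
  have hr : ∀ v, IsLinearMap ℝ (sphereForm p n v) := fun v ↦
    ⟨fun a b ↦ by simp [sphereForm, inner_add_right, mul_add], fun a b ↦ by
      simp only [sphereForm, Prod.smul_fst, inner_smul_right, smul_eq_mul]; ring⟩
  rw [h.sum_eq h' hl hr, Fintype.sum_sum_type]
  have h1 : ∀ i, sphereForm p n (c' (Sum.inl i)) (d' (Sum.inl i)) = 1 := fun i ↦ by
    simp only [sphereForm, c', d', Sum.elim_inl, inner_smul_right, hs, if_true]
    rw [mul_one, mul_inv_cancel₀ hc]
  have h2 : ∀ i, sphereForm p n (c' (Sum.inr i)) (d' (Sum.inr i)) = 0 := fun i ↦ by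
    simp [sphereForm, c', d']
  simp [h1, h2]

/-- Each product is off by at most `δ² + 2δ ≤ 3δ`. It is applied with Kronecker symbols for `x, y,
x', y'`. -/
theorem abs_mul_sub_mul_le {a b a' b' x y x' y' δ : ℝ} (hδ : δ ≤ 1)
    (ha : |a - x| ≤ δ) (hb : |b - y| ≤ δ) (ha' : |a' - x'| ≤ δ) (hb' : |b' - y'| ≤ δ)
    (hx : |x| ≤ 1) (hy : |y| ≤ 1) (hx' : |x'| ≤ 1) (hy' : |y'| ≤ 1) :
    |(a * b - a' * b') - (x * y - x' * y')| ≤ 6 * δ := by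
  have key : ∀ {a b x y : ℝ}, |a - x| ≤ δ → |b - y| ≤ δ → |x| ≤ 1 → |y| ≤ 1 →
      |a * b - x * y| ≤ 3 * δ := fun {a b x y} ha hb hx hy ↦ by
    have h0 : 0 ≤ δ := (abs_nonneg _).trans ha
    have e : a * b - x * y = (a - x) * (b - y) + (a - x) * y + x * (b - y) := by ring
    rw [e]
    refine (abs_add_three _ _ _).trans ?_
    rw [abs_mul, abs_mul, abs_mul]
    have h1 : |a - x| * |b - y| ≤ δ * 1 := mul_le_mul ha (hb.trans hδ) (abs_nonneg _) h0
    have h2 : |a - x| * |y| ≤ δ * 1 := mul_le_mul ha hy (abs_nonneg _) h0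
    have h3 : |x| * |b - y| ≤ 1 * δ := mul_le_mul hx hb (abs_nonneg _) zero_le_one
    linarith
  have e : (a * b - a' * b') - (x * y - x' * y') = (a * b - x * y) - (a' * b' - x' * y') := by ring
  rw [e]
  refine (abs_sub _ _).trans ?_
  linarith [key ha hb hx hy, key ha' hb' hx' hy']

end AmbientEstimates

/-! ### Curvature components in a frame whose tangent vectors are nearly tangent to the sphere. -/

section AmbientFrames

variable {p n : ℕ} {X₂ : Type*} [TopologicalSpace X₂] [ChartedSpace (EuclideanSpace ℝ (Fin n)) X₂]
    [IsManifold (𝓡 n) ∞ X₂]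
    (g₂ : Bundle.ContMDiffRiemannianMetric (𝓡 n) ∞ (EuclideanSpace ℝ (Fin n))
      (TangentSpace (𝓡 n) : X₂ → Type _))

theorem factorForm_self_nonneg (x : X₂) (u : EuclideanSpace ℝ (Fin n)) :
    0 ≤ MetricField.at (I := 𝓡 n) g₂.inner x u u := by
  by_cases h : u = 0
  · simp [h]
  · exact (g₂.pos x u h).le

theorem abs_factorForm_le (x : X₂) (u v : EuclideanSpace ℝ (Fin n)) :
    |MetricField.at (I := 𝓡 n) g₂.inner x u v| ≤
      √(MetricField.at (I := 𝓡 n) g₂.inner x u u) * √(MetricField.at (I := 𝓡 n) g₂.inner x v v) :=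
  abs_form_le (b := MetricField.at (I := 𝓡 n) g₂.inner x) (fun u v ↦ g₂.symm x u v)
    (fun u hu ↦ g₂.pos x u hu) u v

/-- In an adapted frame whose tangent vectors have small second component, the curvature components
of the product with a sphere differ little from those of the sphere. -/
theorem loweredCurvature_adaptedFrame (hp : 2 ≤ p) (x : Sph p × X₂) {K : ℝ}
    (hK : 0 ≤ K) (hcurv : ∀ u v w z : EuclideanSpace ℝ (Fin n),
      |MetricField.at (I := 𝓡 n) g₂.inner x.2 (curvature (I := 𝓡 n) g₂.inner x.2 u v w) z| ≤
        K * (√(MetricField.at (I := 𝓡 n) g₂.inner x.2 u u) *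
          √(MetricField.at (I := 𝓡 n) g₂.inner x.2 v v) *
          √(MetricField.at (I := 𝓡 n) g₂.inner x.2 w w) *
          √(MetricField.at (I := 𝓡 n) g₂.inner x.2 z z)))
    {c : Fin p ⊕ Fin n → EuclideanSpace ℝ (Fin p) × EuclideanSpace ℝ (Fin n)}
    (hc : IsDualPair ((ambientMetric p g₂.inner).at x) c c) {δ : ℝ} (hδ₁ : δ ≤ 1)
    (hδ : ∀ i, MetricField.at (I := 𝓡 n) g₂.inner x.2 (c (.inl i)).2 (c (.inl i)).2 ≤ δ) :
    (∀ i l r j, |loweredCurvature (ambientMetric p g₂.inner) x (c (.inl i)) (c (.inl l))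
      (c (.inr r)) (c (.inr j))| ≤ (p + 3 + K) * δ) ∧
    (∀ i l k s, |loweredCurvature (ambientMetric p g₂.inner) x (c (.inl i)) (c (.inl l))
      (c (.inl k)) (c (.inl s)) - constantCurvature (2 * ((p : ℝ) - 1))⁻¹ i l k s| ≤
        (p + 3 + K) * δ) ∧
    (∀ i r j, |loweredCurvature (ambientMetric p g₂.inner) x (c (.inl i)) (c (.inr r))
      (c (.inl i)) (c (.inr j))| ≤ (p + 3 + K) * δ) := by
  have hp' : (2 : ℝ) ≤ p := by exact_mod_cast hp
  set b := MetricField.at (I := 𝓡 n) g₂.inner x.2 with hb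
  have hb0 : ∀ u, 0 ≤ b u u := factorForm_self_nonneg g₂ x.2
  have hδ0 : 0 ≤ δ := (hb0 _).trans (hδ ⟨0, by omega⟩)
  set κ := (2 * ((p : ℝ) - 1))⁻¹ with hκ
  have hκ0 : 0 ≤ κ := inv_nonneg.2 (by linarith)
  have hκ1 : κ ≤ 1 / 2 := by
    rw [hκ, ← one_div]
    exact one_div_le_one_div_of_le (by norm_num) (by linarith)
  have hG : ∀ i j, sphereForm p n (c i) (c j) + b (c i).2 (c j).2 = if i = j then 1 else 0 :=
    fun i j ↦ by rw [← hc.apply, ambientMetric_eq]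
  have hS1 : ∀ i, sphereForm p n (c i) (c i) ≤ 1 := fun i ↦ by
    have := hG i i
    rw [if_pos rfl] at this
    linarith [hb0 (c i).2]
  have hb1 : ∀ i, b (c i).2 (c i).2 ≤ 1 := fun i ↦ by
    have := hG i i
    rw [if_pos rfl] at this
    linarith [sphereForm_self_nonneg hp (c i)]
  -- The trace of the sphere form is `p`, and the `p` tangent vectors account for at least `p(1 -
  -- δ)` of it.
  have hSn : ∀ j, sphereForm p n (c (.inr j)) (c (.inr j)) ≤ p * δ := fun j ↦ by
    have h1 := sum_sphereForm g₂ hp x hc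
    rw [Fintype.sum_sum_type] at h1
    have h2 := Finset.single_le_sum (f := fun j ↦ sphereForm p n (c (.inr j)) (c (.inr j)))
      (fun j _ ↦ sphereForm_self_nonneg hp _) (Finset.mem_univ j)
    have h3 : ∑ i : Fin p, (1 - δ) ≤ ∑ i : Fin p, sphereForm p n (c (.inl i)) (c (.inl i)) :=
      Finset.sum_le_sum fun i _ ↦ by
        have := hG (.inl i) (.inl i)
        rw [if_pos rfl] at this
        linarith [hδ i]
    simp at h3
    linarith
  have hsq : ∀ {t : ℝ}, t ≤ 1 → √t ≤ 1 := fun ht ↦ by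
    rw [← Real.sqrt_one]
    exact Real.sqrt_le_sqrt ht
  have hTN : ∀ i j, |sphereForm p n (c (.inl i)) (c (.inr j))| ≤ √(p * δ) := fun i j ↦ by
    refine (abs_sphereForm_le hp _ _).trans ?_
    have := mul_le_mul (hsq (hS1 (.inl i))) (Real.sqrt_le_sqrt (hSn j)) (Real.sqrt_nonneg _)
      zero_le_one
    linarith
  have hTN' : ∀ i j i' j', |sphereForm p n (c (.inl i)) (c (.inr j)) *
      sphereForm p n (c (.inl i')) (c (.inr j'))| ≤ p * δ := fun i j i' j' ↦ by
    rw [abs_mul]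
    refine (mul_le_mul (hTN i j) (hTN i' j') (abs_nonneg _) (Real.sqrt_nonneg _)).trans_eq ?_
    exact Real.mul_self_sqrt (by positivity)
  have hTT : ∀ i j, |sphereForm p n (c (.inl i)) (c (.inl j))| ≤ 1 := fun i j ↦ by
    refine (abs_sphereForm_le hp _ _).trans ?_
    exact mul_le_one₀ (hsq (hS1 _)) (Real.sqrt_nonneg _) (hsq (hS1 _))
  have hNN : ∀ i j, |sphereForm p n (c (.inr i)) (c (.inr j))| ≤ p * δ := fun i j ↦ by
    refine (abs_sphereForm_le hp _ _).trans ?_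
    refine (mul_le_mul (Real.sqrt_le_sqrt (hSn i)) (Real.sqrt_le_sqrt (hSn j))
      (Real.sqrt_nonneg _) (Real.sqrt_nonneg _)).trans_eq ?_
    exact Real.mul_self_sqrt (by positivity)
  have hbT : ∀ i, √(b (c (.inl i)).2 (c (.inl i)).2) ≤ √δ := fun i ↦ Real.sqrt_le_sqrt (hδ i)
  have hb1' : ∀ i, √(b (c i).2 (c i).2) ≤ 1 := fun i ↦ hsq (hb1 i)
  have hδδ : √δ * √δ = δ := Real.mul_self_sqrt hδ0
  -- The bound `κ ≤ 1/2` absorbs the two summands.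
  have hpair : ∀ {s t : ℝ}, |s| ≤ p * δ → |t| ≤ p * δ → |κ * (s - t)| ≤ p * δ := fun hs ht ↦ by
    rw [abs_mul, abs_of_nonneg hκ0]
    have h1 := (abs_sub _ _).trans (add_le_add hs ht)
    have := mul_le_mul hκ1 h1 (abs_nonneg _) (by norm_num)
    linarith
  -- In the `X₂` curvature two tangent arguments contribute `√δ` each, and the other two at most
  -- `1`.
  have hR : ∀ {s₁ s₂ s₃ s₄ : ℝ}, 0 ≤ s₁ → 0 ≤ s₂ → 0 ≤ s₃ → 0 ≤ s₄ → s₁ ≤ √δ → s₂ ≤ √δ → s₃ ≤ 1 →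
      s₄ ≤ 1 → K * (s₁ * s₂ * s₃ * s₄) ≤ K * δ := fun {s₁ s₂ s₃ s₄} h1 h2 h3 h4 l1 l2 l3 l4 ↦ by
    refine mul_le_mul_of_nonneg_left ?_ hK
    calc s₁ * s₂ * s₃ * s₄ ≤ √δ * √δ * 1 * 1 := by gcongr
      _ = δ := by rw [hδδ, mul_one, mul_one]
  refine ⟨fun i l r j ↦ ?_, fun i l k s ↦ ?_, fun i r j ↦ ?_⟩
  · rw [loweredCurvature_ambientMetric g₂ hp]
    have h1 := hpair (hTN' l r i j) (hTN' i r l j)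
    have h2 := (hcurv (c (.inl i)).2 (c (.inl l)).2 (c (.inr r)).2 (c (.inr j)).2).trans
      (hR (Real.sqrt_nonneg _) (Real.sqrt_nonneg _) (Real.sqrt_nonneg _) (Real.sqrt_nonneg _)
        (hbT i) (hbT l) (hb1' _) (hb1' _))
    refine (abs_add_le _ _).trans ?_
    linarith
  · rw [loweredCurvature_ambientMetric g₂ hp, constantCurvature]
    have hε : ∀ i j, |sphereForm p n (c (.inl i)) (c (.inl j)) - if i = j then 1 else 0| ≤ δ :=
      fun i j ↦ by
        have h := hG (.inl i) (.inl j)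
        simp only [Sum.inl.injEq] at h
        rw [← h, sub_add_cancel_left, abs_neg]
        refine (abs_factorForm_le g₂ x.2 _ _).trans ?_
        refine (mul_le_mul (hbT i) (hbT j) (Real.sqrt_nonneg _) (Real.sqrt_nonneg _)).trans_eq hδδ
    have hite : ∀ i j : Fin p, |if i = j then (1 : ℝ) else 0| ≤ 1 := fun i j ↦ by
      split_ifs <;> simp
    -- Tangent inner products on the sphere are within `δ` of Kronecker symbols. The resulting `6δ`,
    -- times `κ ≤ 1/2`, is the `3` in the bound.
    have h1 := abs_mul_sub_mul_le hδ₁ (hε l k) (hε i s) (hε i k) (hε l s) (hite _ _) (hite _ _)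
      (hite _ _) (hite _ _)
    have h2 := (hcurv (c (.inl i)).2 (c (.inl l)).2 (c (.inl k)).2 (c (.inl s)).2).trans
      (hR (Real.sqrt_nonneg _) (Real.sqrt_nonneg _) (Real.sqrt_nonneg _) (Real.sqrt_nonneg _)
        (hbT i) (hbT l) (hb1' _) (hb1' _))
    have h3 := mul_le_mul hκ1 h1 (abs_nonneg _) (by norm_num)
    rw [← abs_of_nonneg hκ0, ← abs_mul] at h3
    rw [← hκ, add_sub_right_comm, ← mul_sub]
    refine (abs_add_le _ _).trans ?_
    have : 0 ≤ p * δ := by positivity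
    linarith
  · rw [loweredCurvature_ambientMetric g₂ hp, sphereForm_comm (c (.inr r)) (c (.inl i))]
    have h0 : |sphereForm p n (c (.inl i)) (c (.inl i)) *
        sphereForm p n (c (.inr r)) (c (.inr j))| ≤ p * δ := by
      rw [abs_mul]
      refine (mul_le_mul (hTT i i) (hNN r j) (abs_nonneg _) zero_le_one).trans_eq (one_mul _)
    have h1 := hpair (hTN' i r i j) h0
    have h2 := (hcurv (c (.inl i)).2 (c (.inr r)).2 (c (.inl i)).2 (c (.inr j)).2)
    have h3 := hR (Real.sqrt_nonneg (b (c (.inl i)).2 (c (.inl i)).2))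
      (Real.sqrt_nonneg (b (c (.inl i)).2 (c (.inl i)).2))
      (Real.sqrt_nonneg (b (c (.inr r)).2 (c (.inr r)).2))
      (Real.sqrt_nonneg (b (c (.inr j)).2 (c (.inr j)).2)) (hbT i) (hbT i) (hb1' _) (hb1' _)
    -- The tangent arguments are the first and the third here, and are brought together to apply
    -- `hR`.
    rw [mul_right_comm (√(b (c (.inl i)).2 (c (.inl i)).2)) (√(b (c (.inr r)).2 (c (.inr r)).2))]
      at h2
    have h4 := h2.trans h3
    refine (abs_add_le _ _).trans ?_
    linarith

omit [IsManifold (𝓡 n) ∞ X₂] in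
theorem mfderiv_snd_comp {M : Type*} [TopologicalSpace M]
    [ChartedSpace (EuclideanSpace ℝ (Fin p)) M] {f : M → Sph p × X₂}
    {m : M} (hf : MDifferentiableAt (𝓡 p) ((𝓡 p).prod (𝓡 n)) f m) (u : EuclideanSpace ℝ (Fin p)) :
    (mfderiv (𝓡 p) (𝓡 n) (fun q ↦ (f q).2) m u : EuclideanSpace ℝ (Fin n)) =
      (tangentMap' ((𝓡 p).prod (𝓡 n)) (𝓡 p) f m u).2 := by
  have h := (hasMFDerivAt_snd (I := 𝓡 p) (I' := 𝓡 n) (f m)).comp m hf.hasMFDerivAt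
  have h1 := h.mfderiv
  exact congrArg (fun l : EuclideanSpace ℝ (Fin p) →L[ℝ] EuclideanSpace ℝ (Fin n) ↦ l u) h1

end AmbientFrames

end

/-! ### The inequality. -/

theorem mainTheorem5 (p : ℕ) (hp : 2 ≤ p) (n : ℕ) (X₂ : Type*) [TopologicalSpace X₂] [T2Space X₂]
    [SecondCountableTopology X₂] [ChartedSpace (EuclideanSpace ℝ (Fin n)) X₂]
    [IsManifold (𝓡 n) ∞ X₂]
    (g₂ : Bundle.ContMDiffRiemannianMetric (𝓡 n) ∞ (EuclideanSpace ℝ (Fin n))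
      (TangentSpace (𝓡 n) : X₂ → Type _))
    (hX₂ : IsCompactTypeSymmetric (I := 𝓡 n) g₂.inner) :
    ∃ C : ℝ, 0 < C ∧
      ∀ (M : Type*) [TopologicalSpace M] [T2Space M] [CompactSpace M]
        [ChartedSpace (EuclideanSpace ℝ (Fin p)) M] [IsManifold (𝓡 p) ∞ M]
        (f : M → Sph p × X₂),
        IsSmoothImmersion ((𝓡 p).prod (𝓡 n)) (𝓡 p) f →
        IsMinimal (𝓡 p) (ambientMetric p g₂.inner) f →
        ∀ Λ : ℝ, 0 ≤ Λ → ProjNormLE g₂.inner f Λ →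
        ∀ (m : M) (e : Fin p → EuclideanSpace ℝ (Fin p))
          (η : Fin n → EuclideanSpace ℝ (Fin p) × EuclideanSpace ℝ (Fin n)),
          IsAdaptedFrame (𝓡 p) (ambientMetric p g₂.inner) f m e η →
          simonsInner (𝓡 p) (ambientMetric p g₂.inner) f m e η ≥
            ((2 * smallestRicci (ambientMetric p g₂.inner) + 1 / ((p : ℝ) - 1)) - C * Λ ^ 2)
              * normSqA (𝓡 p) (ambientMetric p g₂.inner) f m e η := by
  have := hX₂.connected
  obtain ⟨K, hK, hcurv⟩ := exists_curvature_bound g₂ hX₂.symmetry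
  have hp' : (2 : ℝ) ≤ p := by exact_mod_cast hp
  set C₀ : ℝ := n * p ^ 3 * (5 * n + 4 * p) * (p + 3 + K) with hC₀
  have hC₀0 : 0 ≤ C₀ := by positivity
  -- The `1` ensures positivity: `C₀` vanishes for `n = 0`.
  refine ⟨C₀ + 1, by linarith, ?_⟩
  intro M _ _ _ _ _ f hf hmin Λ hΛ hproj m e η he
  have symm := ambientMetric_symm g₂ (f m)
  have pos := ambientMetric_pos g₂ hp (f m)
  have hinj : Function.Injective (tangentMap' ((𝓡 p).prod (𝓡 n)) (𝓡 p) f m) :=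
    hf.injective_mfderiv m
  have hE : finrank ℝ (EuclideanSpace ℝ (Fin p) × EuclideanSpace ℝ (Fin n)) = p + n := by simp
  have hF : finrank ℝ (EuclideanSpace ℝ (Fin p)) = p := by simp
  have hdual := isDualPair_adaptedFrame hE symm he
  -- The perturbation estimate needs `δ ≤ 1`. Capping at `1` is harmless, since the frame vectors
  -- have unit length, and covers large `Λ`.
  set δ := min (Λ ^ 2) 1 with hδ
  have hsmall : ∀ i, MetricField.at (I := 𝓡 n) g₂.inner (f m).2
      (adaptedFrame ((𝓡 p).prod (𝓡 n)) (𝓡 p) f m e η (.inl i)).2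
      (adaptedFrame ((𝓡 p).prod (𝓡 n)) (𝓡 p) f m e η (.inl i)).2 ≤ δ := fun i ↦ by
    have h0 := hdual.apply (.inl i) (.inl i)
    rw [if_pos rfl, ambientMetric_eq] at h0
    refine le_min ?_ (by
      linarith [sphereForm_self_nonneg hp (adaptedFrame ((𝓡 p).prod (𝓡 n)) (𝓡 p) f m e η (.inl i))])
    have h1 := hproj m (e i)
    have h2 : ∀ v : EuclideanSpace ℝ (Fin n),
        mfderiv (𝓡 p) (𝓡 n) (fun q ↦ (f q).2) m (e i) = v →
        √(MetricField.at (I := 𝓡 n) g₂.inner (f m).2 v v) ≤ Λ * √(inducedMetric (𝓡 p)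
          (ambientMetric p g₂.inner) f m (e i) (e i)) := by
      rintro _ rfl
      exact h1
    have h3 := h2 _ (mfderiv_snd_comp ((hf.contMDiff m).mdifferentiableAt (by simp)) (e i))
    rw [he.tangent_self, Real.sqrt_one, mul_one] at h3
    exact (Real.sqrt_le_left hΛ).1 h3
  obtain ⟨hX, hQ, hZ⟩ := loweredCurvature_adaptedFrame g₂ hp (f m) hK (hcurv (f m).2) hdual
    (min_le_right _ _) hsmall
  have hBsymm : ∀ j k l, secondFundamentalComponent (𝓡 p) (ambientMetric p g₂.inner) f m e η j k l =
      secondFundamentalComponent (𝓡 p) (ambientMetric p g₂.inner) f m e η j l k := fun j k l ↦ by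
    have hU : extChartAt ((𝓡 p).prod (𝓡 n)) (f m) (f m) ∈
        (extChartAt (𝓡 p) (f m).1).target ×ˢ (extChartAt (𝓡 n) (f m).2).target := by
      rw [extChartAt_prod]
      exact ⟨mem_extChartAt_target (f m).1, mem_extChartAt_target (f m).2⟩
    have hB : secondFundamentalForm (𝓡 p) (ambientMetric p g₂.inner) f m (e k) (e l) =
        secondFundamentalForm (𝓡 p) (ambientMetric p g₂.inner) f m (e l) (e k) :=
      secondFundamentalForm_symm (isFlatMetricOn_chartMetric_prod (f m)
        (isFlatMetricOn_chartMetric_sphereMetric hp (f m).1)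
        (isFlatMetricOn_chartMetric g₂ (f m).2)) hU hf.contMDiff _ _
    rw [secondFundamentalComponent, hB, secondFundamentalComponent]
  have main := sum_simonsComponent_ge hBsymm
    (sum_secondFundamentalComponent_eq_zero hF pos hinj he hmin) hX hQ hZ
  have hN := normSqA_eq hF pos hinj he
  rw [← hN] at main
  rw [simonsInner_eq pos hinj]
  simp_rw [simonsTerm_eq hE hF symm pos hinj he]
  refine ge_iff_le.2 (le_trans ?_ main)
  refine mul_le_mul_of_nonneg_right ?_ ?_
  · have h1 := smallestRicci_ambientMetric_le g₂ hp (f m)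
    -- The eigenvalue of the model, to be compared with `2ρ + 1/(p-1)` by means of `ρ ≤ 1/2`.
    have h2 : (2 * ((p : ℝ) - 1))⁻¹ * (2 * (p - 1) + 2) = 1 + 1 / ((p : ℝ) - 1) := by
      have : (p : ℝ) - 1 ≠ 0 := by linarith
      field_simp
    have h3 : C₀ * δ ≤ (C₀ + 1) * Λ ^ 2 :=
      mul_le_mul (by linarith) (min_le_left _ _) (le_min (sq_nonneg Λ) zero_le_one) (by linarith)
    have h4 : n * (p : ℝ) ^ 3 * (5 * n + 4 * p) * ((p + 3 + K) * δ) = C₀ * δ := by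
      rw [hC₀]
      ring
    rw [h2, h4]
    linarith
  · rw [hN]
    exact Finset.sum_nonneg fun j _ ↦ Finset.sum_nonneg fun k _ ↦ Finset.sum_nonneg fun l _ ↦
      sq_nonneg _
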